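/- \textbf{Conventions.} For tuples of endomorphisms of finite-dimensional complex vector spaces, $\mathbf A\sim\mathbf B$ means simultaneous similarity. For $\mathbf A=(A_1,\dots,A_p)\in\mathrm{End}(V)^p$ put $M_\mu(\mathbf A)=(A_1+\mu_1,\dots,A_p+\mu_p)$ for $\mu\in\mathbb C^p$ and $T_{(p+1,\infty)}(\mathbf A)=(A_1,\dots,A_p,-(A_1+\cdots+A_p))$. For $\lambda\in\mathbb C$ let $G_j\in\mathrm{End}(V^p)$ be the endomorphism whose $j$-th block row is $(A_1,\dots,A_{j-1},A_j+\lambda,A_{j+1},\dots,A_p)$ and whose other block rows are $0$. The middle convolution $mc_\lambda(\mathbf A)$ is the tuple of endomorphisms induced by $G_1,\dots,G_p$ on $V^p/(\mathcal K+\mathcal L_\lambda)$, where $\mathcal K=\{u: A_ju_j=0\ \forall j\}$ and $\mathcal L_\lambda=\ker(G_1+\cdots+G_p)$. For $m_1\ge\cdots\ge m_N\ge0$ and $\lambda\in\mathbb C^N$, $L(\mathbf m;\lambda)$ is the block matrix with blocks of sizes $m_i\times m_j$, with diagonal blocks $\lambda_iI_{m_i}$, blocks $\binom{I_{m_{i+1}}}{0}$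 in positions $(i,i+1)$ and zero blocks elsewhere; for unsorted $\mathbf m$ one first reorders the pairs $(m_i,\lambda_i)$ so that $\mathbf m$ is weakly decreasing. The tuple $\mathbf A$ has a Riemann scheme with columns $([\lambda_{j,\nu}]_{(m_{j,\nu})})_\nu$, $j=0,\dots,p$ ($j=0$ being the column $x=\infty$), if $A_j\sim L(\mathbf m_j;\lambda_j)$ for $j=0,\dots,p$, where $A_0=-(A_1+\cdots+A_p)$. Multiplicities $0$ are allowed. A system of Okubo normal form (ONF) is $(xI_n-T)\frac{du}{dx}=Au$ with $T=\mathrm{diag}(t_1I_{n_1},\dots,t_pI_{n_p})$, the $t_j\in\mathbb C$ pairwise distinct, $n_j\ge0$, $n=n_1+\cdots+n_p$ and $A\in M(n,\mathbb C)$. Let $P_j=\mathrm{diag}(0,\dots,0,I_{n_j},0,\dots,0)$. The residue matrices are $A_j=P_jA$, so that the system is $\frac{du}{dx}=\sum_j\frac{A_j}{x-t_j}u$, and its Riemann scheme is that of $(A_1,\dots,A_p)$. It is linearly irreducible if $A_1,\dots,A_p$ have no common invariant subspace other than $\{0\}$ and $\mathbb C^n$. Consider the conditions $$(\ast)\qquad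 \mathrm{rank}\,A=n,\qquad \mathrm{rank}\bigl((A+\tau)P_i\bigr)=\mathrm{rank}\bigl(P_i(A+\tau)\bigr)=n_i\quad(\tau\in\mathbb C,\ i=1,\dots,p).$$ \textbf{Theorem (Extending operation).} Let $(xI_n-T)\frac{du}{dx}=Au$ be a system of ONF satisfying $(\ast)$, let $\rho_1,\rho_2\in\mathbb C$ with $\rho_1\rho_2\ne0$, and let $t_{p+1}\in\mathbb C\setminus\{t_1,\dots,t_p\}$. Put $$\hat V=\mathbb C^n\oplus\mathrm{Im}(A-\rho_1)(A-\rho_2),\quad \hat A=\begin{pmatrix}A&I_n\\-(A-\rho_1)(A-\rho_2)&-A+\rho_1+\rho_2\end{pmatrix},\quad \hat T=\begin{pmatrix}T&\\&t_{p+1}\end{pmatrix}\in\mathrm{End}(\hat V),$$ $$n_{p+1}=\dim\mathrm{Im}(A-\rho_1)(A-\rho_2),\qquad \hat n=\dim\hat V=n+n_{p+1}.$$ Then, under a suitable identification $\hat V\simeq\mathbb C^{\hat n}$, $(xI_{\hat n}-\hat T)\frac{du}{dx}=\hat Au$ is a system of ONF with points $t_1,\dots,t_{p+1}$ and block sizes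 $n_1,\dots,n_{p+1}$, whose residue tuple satisfies $$(\hat A_1,\dots,\hat A_{p+1})\sim mc_{\rho_1}\circ M_{(0,\dots,0,\rho_2-\rho_1)}\circ T_{(p+1,\infty)}\circ mc_{-\rho_1}(A_1,\dots,A_p).$$ This system again satisfies $(\ast)$, and it is linearly irreducible if and only if the original one is. Moreover, suppose that the original system has the Riemann scheme with column $[-\mu_1]_{(m_1)},[-\mu_2]_{(m_2)},\dots,[-\mu_q]_{(m_q)}$ at $x=\infty$ and column $[0]_{(n-n_j)},[\lambda_{j,1}]_{(\ell_{j,1})},\dots,[\lambda_{j,r_j}]_{(\ell_{j,r_j})}$ at $x=t_j$ ($j=1,\dots,p$), normalized (as one may, allowing $m_1$ or $m_2$ to be $0$) so that $\rho_1=\mu_1$, $\rho_2=\mu_2$, so that $m_\nu\le m_1$ whenever $\mu_\nu=\rho_1$, and so that $m_\nu\le m_2$ whenever $\nu>1$ and $\mu_\nu=\rho_2$. Then $\hat n=2n-m_1-m_2$, and the new system has the Riemann scheme with columns $$\begin{aligned} x=\infty:&\quad [-\mu_1]_{(n-m_2)},\ [-\mu_2]_{(n-m_1)};\\ x=t_j\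 (j=1,\dots,p):&\quad [0]_{(\hat n-n_j)},\ [\lambda_{j,1}]_{(\ell_{j,1})},\dots,[\lambda_{j,r_j}]_{(\ell_{j,r_j})};\\ x=t_{p+1}:&\quad [0]_{(n)},\ [\mu_1+\mu_2-\mu_3]_{(m_3)},\dots,[\mu_1+\mu_2-\mu_q]_{(m_q)}. \end{aligned}$$ -/

import Mathlib

noncomputable section

namespace Okubo

/-! ### Tuples of endomorphisms: similarity, irreducibility, Katz's operations -/

section Tuples

variable {V W : Type*} [AddCommGroup V] [Module ℂ V] [AddCommGroup W] [Module ℂ W]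

/-- Simultaneous similarity `𝐀 ∼ 𝐁` of two tuples of endomorphisms. -/
def Similar {ι : Type*} (A : ι → Module.End ℂ V) (B : ι → Module.End ℂ W) : Prop :=
  ∃ e : V ≃ₗ[ℂ] W, ∀ j, B j = e.conj (A j)

/-- `𝐀` is irreducible: every common invariant subspace is trivial.  For the residue matrices of a
Fuchsian system this is linear irreducibility of the system. -/
def IsLinearlyIrreducible {ι : Type*} (A : ι → Module.End ℂ V) : Prop :=
  ∀ U : Submodule ℂ V, (∀ j, ∀ u ∈ U, A j u ∈ U) → U = ⊥ ∨ U = ⊤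

variable {p : ℕ}

/-- The addition `M_μ(𝐀) = (A₁ + μ₁, …, A_p + μ_p)`. -/
def addition (μ : Fin p → ℂ) (A : Fin p → Module.End ℂ V) : Fin p → Module.End ℂ V :=
  fun j => A j + μ j • 1

/-- `T_{(j,∞)}` replaces the `j`-th entry by `-(B₁ + ⋯ + B_p)`. -/
def swapInfinity (j : Fin p) (B : Fin p → Module.End ℂ V) : Fin p → Module.End ℂ V :=
  Function.update B j (-∑ i, B i)

/-- The identification of a `p`-tuple `(B₁, …, B_p)` with the `(p+1)`-tuple `(B₁, …, B_p, 0)`. -/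
def appendZero (B : Fin p → Module.End ℂ V) : Fin (p + 1) → Module.End ℂ V :=
  Fin.snoc (α := fun _ => Module.End ℂ V) B 0

/-- The convolution matrices `G_j` acting on `V^p`: the `j`-th block row of `G_j` is
`(A₁, …, A_j + lam, …, A_p)`, all other block rows vanish. -/
def convolution (lam : ℂ) (A : Fin p → Module.End ℂ V) (j : Fin p) :
    Module.End ℂ (Fin p → V) :=
  LinearMap.single ℂ (fun _ : Fin p => V) j ∘ₗ
    ((∑ i, A i ∘ₗ LinearMap.proj i) + lam • LinearMap.proj j)

theorem convolution_apply (lam : ℂ) (A : Fin p → Module.End ℂ V) (j : Fin p) (u : Fin p → V) :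
    convolution lam A j u = Pi.single j ((∑ i, A i (u i)) + lam • u j) := by
  simp [convolution]

/-- The subspace `𝒦 = {u | A_j u_j = 0 for all j}`. -/
def convK (A : Fin p → Module.End ℂ V) : Submodule ℂ (Fin p → V) :=
  Submodule.pi Set.univ fun j => LinearMap.ker (A j)

/-- The subspace `𝓛_lam = ker (G₁ + ⋯ + G_p)`. -/
def convL (lam : ℂ) (A : Fin p → Module.End ℂ V) : Submodule ℂ (Fin p → V) :=
  LinearMap.ker (∑ j, convolution lam A j)

theorem convolution_invariant (lam : ℂ) (A : Fin p → Module.End ℂ V) (j : Fin p) :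
    convK A ⊔ convL lam A ≤ (convK A ⊔ convL lam A).comap (convolution lam A j) := by
  refine sup_le (fun u hu => ?_) (fun u hu => ?_)
  · refine Submodule.mem_sup_left (S := convK A) ?_
    have hu' : ∀ i, A i (u i) = 0 := fun i => by simpa using hu i (Set.mem_univ i)
    rw [convolution_apply]
    intro i _
    rcases eq_or_ne i j with rfl | hij
    · simp [hu']
    · simp [Pi.single_eq_of_ne hij]
  · have h : (∑ i, convolution lam A i) u = 0 := hu
    have h0 : convolution lam A j u = 0 := by
      have hj := congrFun h j
      rw [LinearMap.sum_apply, Finset.sum_apply] at hj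
      simp only [convolution_apply, Pi.zero_apply] at hj
      rw [Finset.sum_eq_single j (fun i _ hij => Pi.single_eq_of_ne hij.symm _)
        (fun h => absurd (Finset.mem_univ j) h), Pi.single_eq_same] at hj
      rw [convolution_apply, hj, Pi.single_zero]
    rw [Submodule.mem_comap, h0]
    exact Submodule.zero_mem _

/-- The middle convolution `mc_lam(𝐀)`: the endomorphisms of `V^p / (𝒦 + 𝓛_lam)` induced by the
convolution matrices `G_j`. -/
def middleConvolution (lam : ℂ) (A : Fin p → Module.End ℂ V) (j : Fin p) :
    Module.End ℂ ((Fin p → V) ⧸ (convK A ⊔ convL lam A)) :=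
  Submodule.mapQ _ _ (convolution lam A j) (convolution_invariant lam A j)

end Tuples

/-! ### The normal forms `L(𝐦; lam)` and Riemann schemes -/

/-- A column of a Riemann scheme: the list of its entries `[lam_ν]_{(m_ν)}`, each written as
`(lam_ν, m_ν)`.  Multiplicities may be `0`. -/
abbrev Column : Type := List (ℂ × ℕ)

/-- The block index set of `L(𝐦; lam)`. -/
abbrev LIndex (c : Column) : Type := Σ i : Fin c.length, Fin (c.get i).2

/-- `L(𝐦; lam)` for `m₁ ≥ m₂ ≥ ⋯`: diagonal blocks `lam_i I`, blocks `(I; 0)` directly above the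
diagonal, all other blocks `0`. -/
def LSorted (c : Column) : Matrix (LIndex c) (LIndex c) ℂ := fun x y =>
  if x.1 = y.1 then (if (x.2 : ℕ) = y.2 then (c.get x.1).1 else 0)
  else if (x.1 : ℕ) + 1 = y.1 then (if (x.2 : ℕ) = y.2 then 1 else 0)
  else 0

/-- The column reordered so that the multiplicities are weakly decreasing. -/
def Column.sorted (c : Column) : Column := List.insertionSort (fun a b => b.2 ≤ a.2) c

/-- `f ∼ L(𝐦; lam)`, where `c` lists the pairs `(lam_ν, m_ν)` in any order: in some basis the
matrix of `f` is `L` of the reordered column. -/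
def IsSimilarToL {V : Type*} [AddCommGroup V] [Module ℂ V] (f : Module.End ℂ V) (c : Column) :
    Prop :=
  ∃ b : Module.Basis (LIndex c.sorted) ℂ V, LinearMap.toMatrix b b f = LSorted c.sorted

/-- The tuple `𝐀 = (A₁, …, A_p)` has the Riemann scheme with column `cInf` at `x = ∞` (for the
residue `A₀ = -(A₁ + ⋯ + A_p)`) and column `c j` at `x = t_j` (for the residue `A_j`). -/
def HasRiemannScheme {V : Type*} [AddCommGroup V] [Module ℂ V] {p : ℕ}
    (A : Fin p → Module.End ℂ V) (cInf : Column) (c : Fin p → Column) : Prop :=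
  IsSimilarToL (-∑ j, A j) cInf ∧ ∀ j, IsSimilarToL (A j) (c j)

/-! ### Systems of Okubo normal form -/

/-- The data of a Fuchsian system `(x - T) du/dx = A u` of Okubo normal form: distinct points
`t_1, …, t_p`, block sizes `n_1, …, n_p` and a block matrix `A`; here
`T = diag(t_1 I_{n_1}, …, t_p I_{n_p})`. -/
structure System (p : ℕ) where
  n : Fin p → ℕ
  t : Fin p → ℂ
  t_injective : Function.Injective t
  A : Matrix (Σ j, Fin (n j)) (Σ j, Fin (n j)) ℂ

namespace System

variable {p : ℕ} (S : System p)

/-- The space `ℂⁿ = ℂ^{n_1} ⊕ ⋯ ⊕ ℂ^{n_p}`. -/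
abbrev Space : Type := (Σ j, Fin (S.n j)) → ℂ

/-- The rank `n = n_1 + ⋯ + n_p` of the system. -/
def rank : ℕ := ∑ j, S.n j

/-- `T = diag(t_1 I_{n_1}, …, t_p I_{n_p})`. -/
def T : Matrix (Σ j, Fin (S.n j)) (Σ j, Fin (S.n j)) ℂ := Matrix.diagonal fun x => S.t x.1

/-- The block projection `diag(0, …, 0, I_{n_j}, 0, …, 0)`. -/
def blockProj (j : Fin p) : Matrix (Σ j, Fin (S.n j)) (Σ j, Fin (S.n j)) ℂ :=
  Matrix.diagonal fun x => if x.1 = j then 1 else 0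

/-- The residue matrices `A_j` of the Schlesinger form `du/dx = ∑ A_j / (x - t_j) u` of the system:
the `j`-th block row of `A_j` is that of `A`, the other rows vanish. -/
def residue (j : Fin p) : Module.End ℂ S.Space := Matrix.toLin' (S.blockProj j * S.A)

/-- The rank conditions `rank A = n` and, for all `tau` and all `i`,
`rank ((A + tau) diag(0, I_{n_i}, 0)) = n_i = rank (diag(0, I_{n_i}, 0) (A + tau))`. -/
def RankConditions : Prop :=
  S.A.rank = S.rank ∧
  ∀ (tau : ℂ) (i : Fin p),
    ((S.A + tau • (1 : Matrix _ _ ℂ)) * S.blockProj i).rank = S.n i ∧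
    (S.blockProj i * (S.A + tau • (1 : Matrix _ _ ℂ))).rank = S.n i

/-- The matrix `A` as an endomorphism of `ℂⁿ`. -/
def endA : Module.End ℂ S.Space := Matrix.toLin' S.A

/-- The endomorphism `(A - ρ₁)(A - ρ₂)`. -/
def quad (ρ₁ ρ₂ : ℂ) : Module.End ℂ S.Space :=
  (S.endA - ρ₁ • 1) * (S.endA - ρ₂ • 1)

/-- The space `ℂⁿ ⊕ Im (A - ρ₁)(A - ρ₂)`, a subspace of `ℂⁿ ⊕ ℂⁿ`. -/
def extSpace (ρ₁ ρ₂ : ℂ) : Submodule ℂ (S.Space × S.Space) :=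
  Submodule.prod ⊤ (LinearMap.range (S.quad ρ₁ ρ₂))

/-- The block endomorphism `(A, I; -(A - ρ₁)(A - ρ₂), -A + ρ₁ + ρ₂)` of `ℂⁿ ⊕ ℂⁿ`. -/
def extAFull (ρ₁ ρ₂ : ℂ) : Module.End ℂ (S.Space × S.Space) :=
  LinearMap.prod
    (S.endA ∘ₗ LinearMap.fst ℂ _ _ + LinearMap.snd ℂ _ _)
    (-(S.quad ρ₁ ρ₂) ∘ₗ LinearMap.fst ℂ _ _ +
      (-S.endA + (ρ₁ + ρ₂) • 1) ∘ₗ LinearMap.snd ℂ _ _)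

theorem extAFull_mem (ρ₁ ρ₂ : ℂ) :
    ∀ x ∈ S.extSpace ρ₁ ρ₂, S.extAFull ρ₁ ρ₂ x ∈ S.extSpace ρ₁ ρ₂ := by
  rintro ⟨u, v⟩ ⟨-, w, hw⟩
  have hw' : S.quad ρ₁ ρ₂ w = v := hw
  refine ⟨Submodule.mem_top, -u + (-S.endA + (ρ₁ + ρ₂) • 1) w, ?_⟩
  have hc : S.quad ρ₁ ρ₂ * (-S.endA + (ρ₁ + ρ₂) • 1) =
      (-S.endA + (ρ₁ + ρ₂) • 1) * S.quad ρ₁ ρ₂ := by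
    have h1 : ∀ (f : Module.End ℂ S.Space) (a : ℂ), Commute f (a • 1) :=
      fun f a => (Commute.one_right f).smul_right a
    have h2 : ∀ a : ℂ, Commute (S.endA - a • 1) (-S.endA + (ρ₁ + ρ₂) • 1) := fun a =>
      (((Commute.refl S.endA).neg_right).sub_left (h1 _ a).symm).add_right (h1 _ _)
    exact (h2 ρ₁).mul_left (h2 ρ₂)
  have hc' := LinearMap.congr_fun hc w
  simp only [Module.End.mul_apply] at hc'
  rw [map_add, hc', hw', map_neg]
  rfl

/-- `Â`, an endomorphism of `ℂⁿ ⊕ Im (A - ρ₁)(A - ρ₂)`. -/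
def extA (ρ₁ ρ₂ : ℂ) : Module.End ℂ (S.extSpace ρ₁ ρ₂) :=
  (S.extAFull ρ₁ ρ₂).restrict (S.extAFull_mem ρ₁ ρ₂)

theorem extTFull_mem (ρ₁ ρ₂ s : ℂ) :
    ∀ x ∈ S.extSpace ρ₁ ρ₂,
      LinearMap.prodMap (Matrix.toLin' S.T) (s • (1 : Module.End ℂ S.Space)) x ∈
        S.extSpace ρ₁ ρ₂ := by
  rintro ⟨u, v⟩ ⟨-, hv⟩
  exact ⟨Submodule.mem_top, Submodule.smul_mem _ s hv⟩

/-- `T̂ = diag(T, s)`, an endomorphism of `ℂⁿ ⊕ Im (A - ρ₁)(A - ρ₂)`. -/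
def extT (ρ₁ ρ₂ s : ℂ) : Module.End ℂ (S.extSpace ρ₁ ρ₂) :=
  (LinearMap.prodMap (Matrix.toLin' S.T) (s • (1 : Module.End ℂ S.Space))).restrict
    (S.extTFull_mem ρ₁ ρ₂ s)

end System

end Okubo

end

/-! Two mechanisms carry the theorem.

Katz's operations are computed on explicit models of the quotients. Since `A` is invertible, `u ↦ (A
- ρ₁) ∑ A_j u_j` identifies the first middle convolution with the tuple `(A - ρ₁) P_j` on `Im (A -
ρ₁)`. This tuple sums to `A - ρ₁`, so exchanging infinity with the new point and shifting by `ρ₂ -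
ρ₁` gives `ρ₂ - A` as last entry. The map `u ↦ (∑ P_j u_j, (ρ₂ - A) u_{p+1})` then identifies the
second middle convolution with the residues of `Â`. The two halves of the rank condition at `τ =
-ρ₁` say that its kernel is exactly `𝒦` and that it is onto; `𝓛 ≤ 𝒦` follows from injectivity of
`Â`, a consequence of `(Â - ρ₁)(Â - ρ₂) = 0` (`extB_extB`) and `ρ₁ρ₂ ≠ 0`.

Riemann schemes are read off from the numbers `dim ker (f - μ)^k`, which determine the similarity
class (`isSimilarToL_iff_hasKerDims`). The working tool is `HasKerDims.cons_iff`: removing the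
largest multiplicity of `ρ` from a column corresponds to restricting `f` to `Im (f - ρ)`. Peeling
`ρ₁` and `ρ₂` off `A` leaves the rest of the column for `A` on `Im (A - ρ₁)(A - ρ₂)`. Peeling `0`
off each new residue leaves a diagonal block of `Â`: for an old point the same block as before, for
the new point `ρ₁ + ρ₂ - A` on that image. At infinity the quadratic relation leaves only the
dimension of one eigenspace to compute. -/

namespace Okubo

open Module

/-! ### Dimensions of `ker (f - μ)^k` as a complete similarity invariant -/

section LinearAlgebra

variable {V W V' : Type*} [AddCommGroup V] [Module ℂ V] [AddCommGroup W] [Module ℂ W]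
  [AddCommGroup V'] [Module ℂ V']

theorem finrank_comap_eq [FiniteDimensional ℂ V] (F : V →ₗ[ℂ] V') (U : Submodule ℂ V') :
    finrank ℂ (U.comap F) = finrank ℂ (LinearMap.ker F) + finrank ℂ (U ⊓ F.range : Submodule ℂ V') := by
  have h := (F.domRestrict (U.comap F)).finrank_range_add_finrank_ker
  have h1 : (F.domRestrict (U.comap F)).range = U ⊓ F.range := by
    rw [LinearMap.range_domRestrict, Submodule.map_comap_eq, inf_comm]
  have h2 : finrank ℂ (F.domRestrict (U.comap F)).ker = finrank ℂ F.ker := by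
    rw [LinearMap.ker_domRestrict]
    exact (Submodule.comapSubtypeEquivOfLe (LinearMap.ker_le_comap F)).finrank_eq
  rw [h1, h2] at h
  omega

theorem ker_pow_inf_range_eq_map {f : End ℂ V} {g : End ℂ W} (ι : W →ₗ[ℂ] V)
    (hι : Function.Injective ι) (hc : ∀ w, f (ι w) = ι (g w)) (μ : ℂ) (k : ℕ) :
    LinearMap.ker ((f - μ • 1) ^ k) ⊓ ι.range = (LinearMap.ker ((g - μ • 1) ^ k)).map ι := by
  have h : ∀ k w, ((f - μ • 1) ^ k : End ℂ V) (ι w) = ι (((g - μ • 1) ^ k : End ℂ W) w) := by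
    intro k
    have h1 : ∀ w, (f - μ • 1) (ι w) = ι ((g - μ • 1) w) := fun w => by simp [hc]
    induction k with
    | zero => intro w; rw [pow_zero, pow_zero, End.one_apply, End.one_apply]
    | succ k ih => intro w; rw [pow_succ, pow_succ, End.mul_apply, End.mul_apply, h1, ih]
  ext v
  constructor
  · rintro ⟨h1, w, rfl⟩
    refine ⟨w, ?_, rfl⟩
    have h1' : ((f - μ • 1) ^ k : End ℂ V) (ι w) = 0 := h1
    rw [h] at h1'
    exact hι (by rw [h1', map_zero])
  · rintro ⟨w, hw, rfl⟩
    have hw' : ((g - μ • 1) ^ k : End ℂ W) w = 0 := hw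
    exact ⟨(h k w).trans (by rw [hw', map_zero]), w, rfl⟩

/-- `ker (f - ρ)^(k+1)` is the preimage of `ker (f - ρ)^k` under `f - ρ`, so only the part of the
latter inside `Im (f - ρ)` counts. Here `ι` makes `W` a model of this image, with `g` the
restriction of `f`. -/
theorem finrank_ker_pow_succ [FiniteDimensional ℂ V] {f : End ℂ V} {g : End ℂ W} {ρ : ℂ}
    (ι : W →ₗ[ℂ] V) (hι : Function.Injective ι) (hr : ι.range = (f - ρ • 1).range)
    (hc : ∀ w, f (ι w) = ι (g w)) (k : ℕ) :
    finrank ℂ (LinearMap.ker ((f - ρ • 1) ^ (k + 1))) =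
      finrank ℂ (LinearMap.ker (f - ρ • 1)) + finrank ℂ (LinearMap.ker ((g - ρ • 1) ^ k)) := by
  have h1 : LinearMap.ker ((f - ρ • 1) ^ (k + 1)) =
      (LinearMap.ker ((f - ρ • 1) ^ k)).comap (f - ρ • 1) := by
    rw [pow_succ]; rfl
  rw [h1, finrank_comap_eq, ← hr, ker_pow_inf_range_eq_map ι hι hc, (Submodule.equivMapOfInjective ι hι _).finrank_eq]

/-- A vector `v` is a combination of `(f - ρ) v` and `(f - μ) v`, because these differ by a nonzero
multiple of `v`; the second lies in the image by induction. Hence passing to `Im (f - ρ)` loses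
nothing at the other eigenvalues. -/
theorem ker_pow_le_range (f : End ℂ V) {μ ρ : ℂ} (h : μ ≠ ρ) (k : ℕ) :
    LinearMap.ker ((f - μ • 1) ^ k) ≤ (f - ρ • 1).range := by
  induction k with
  | zero => intro v hv; have : v = 0 := by simpa using hv
            rw [this]; exact zero_mem _
  | succ k ih =>
    intro v hv
    rw [LinearMap.mem_ker, pow_succ] at hv
    have h1 : (f - μ • 1) v ∈ (f - ρ • 1).range := ih hv
    have h2 : (f - ρ • 1) v ∈ (f - ρ • 1).range := ⟨v, rfl⟩
    have h3 : v = (μ - ρ)⁻¹ • ((f - ρ • 1) v - (f - μ • 1) v) := by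
      have : (f - ρ • 1) v - (f - μ • 1) v = (μ - ρ) • v := by
        simp [sub_smul]
      rw [this, smul_smul, inv_mul_cancel₀ (sub_ne_zero.2 h), one_smul]
    rw [h3]
    exact Submodule.smul_mem _ _ (Submodule.sub_mem _ h2 h1)

theorem finrank_ker_pow_of_ne {f : End ℂ V} {g : End ℂ W} {ρ μ : ℂ}
    (ι : W →ₗ[ℂ] V) (hι : Function.Injective ι) (hr : ι.range = (f - ρ • 1).range)
    (hc : ∀ w, f (ι w) = ι (g w)) (h : μ ≠ ρ) (k : ℕ) :
    finrank ℂ (LinearMap.ker ((f - μ • 1) ^ k)) = finrank ℂ (LinearMap.ker ((g - μ • 1) ^ k)) := by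
  have h1 := ker_pow_inf_range_eq_map ι hι hc μ k
  rw [hr, inf_eq_left.2 (ker_pow_le_range f h k)] at h1
  rw [h1, (Submodule.equivMapOfInjective ι hι _).finrank_eq]

/-- An intertwiner between the ranges of `F` and `G` extends to an intertwiner of `F` and `G`. -/
theorem exists_injective_extension [FiniteDimensional ℂ V] [FiniteDimensional ℂ V']
    (F : End ℂ V) (G : End ℂ V') (e : F.range ≃ₗ[ℂ] G.range)
    (he : ∀ w : F.range, G (e w) = e ⟨F w, w, rfl⟩)
    (h1 : finrank ℂ (LinearMap.ker F) = finrank ℂ (LinearMap.ker G))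
    (h2 : finrank ℂ (LinearMap.ker F ⊓ F.range : Submodule ℂ V) =
      finrank ℂ (LinearMap.ker G ⊓ G.range : Submodule ℂ V')) :
    ∃ E : V →ₗ[ℂ] V', Function.Injective E ∧ ∀ v, G (E v) = E (F v) := by
  -- `C` and `D` are the parts of the kernels that `e` does not see. They have equal dimension, and
  -- any isomorphism between them will do.
  obtain ⟨C, hC, hC'⟩ := IsModularLattice.exists_disjoint_and_sup_eq (inf_le_left : LinearMap.ker F ⊓ F.range ≤ LinearMap.ker F)
  obtain ⟨D, hD, hD'⟩ := IsModularLattice.exists_disjoint_and_sup_eq (inf_le_left : LinearMap.ker G ⊓ G.range ≤ LinearMap.ker G)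
  have hCK : C ≤ LinearMap.ker F := hC' ▸ le_sup_right
  have hDK : D ≤ LinearMap.ker G := hD' ▸ le_sup_right
  have hCD : finrank ℂ C = finrank ℂ D := by
    have a := Submodule.finrank_sup_add_finrank_inf_eq (LinearMap.ker F ⊓ F.range) C
    have b := Submodule.finrank_sup_add_finrank_inf_eq (LinearMap.ker G ⊓ G.range) D
    rw [hC', hC.eq_bot, finrank_bot] at a
    rw [hD', hD.eq_bot, finrank_bot] at b
    omega
  have hCR : Disjoint C F.range := by
    rw [Submodule.disjoint_def] at hC ⊢
    exact fun x hx hx' => hC x ⟨hCK hx, hx'⟩ hx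
  let k : C ≃ₗ[ℂ] D := LinearEquiv.ofFinrankEq _ _ hCD
  obtain ⟨q, hq, hq'⟩ := hCR.symm.exists_isCompl
  obtain ⟨r, hr, hr'⟩ := hCR.exists_isCompl
  let pC := Submodule.projectionOnto C q hq'.symm
  let pR := Submodule.projectionOnto F.range r hr'.symm
  obtain ⟨sec, hsec⟩ := G.rangeRestrict.exists_rightInverse_of_surjective G.range_rangeRestrict
  have hsec' : ∀ y, G (sec y) = y := fun y => congrArg Subtype.val (LinearMap.congr_fun hsec y)
  let S : V →ₗ[ℂ] V' := sec ∘ₗ e.toLinearMap ∘ₗ F.rangeRestrict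
  have hS : ∀ v, G (S v) = e (F.rangeRestrict v) := fun v => hsec' _
  -- `S` satisfies `G S = e F` but need not extend `e`. Both correction terms take values in `ker
  -- G`, so they keep this relation while forcing `E = e` on `Im F` and `E = k` on `C`.
  let E : V →ₗ[ℂ] V' := S + (G.range.subtype ∘ₗ e.toLinearMap - S ∘ₗ F.range.subtype) ∘ₗ pR +
    D.subtype ∘ₗ k.toLinearMap ∘ₗ pC
  have hE : ∀ v, E v = S v + (e (pR v) - S (pR v)) + k (pC v) := fun v => rfl
  have hER : ∀ w : F.range, E w = e w := by
    intro w
    have a : pR w = w := Submodule.projectionOnto_apply_left _ _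
    have b : pC w = 0 := (Submodule.projectionOnto_apply_eq_zero_iff _).2 (hq w.2)
    rw [hE, a, b]
    simp
  have hEC : ∀ c : C, E c = k c := by
    intro c
    have a : pR c = 0 := (Submodule.projectionOnto_apply_eq_zero_iff _).2 (hr c.2)
    have b : pC c = c := Submodule.projectionOnto_apply_left _ _
    have d : F.rangeRestrict c = 0 := Subtype.ext (hCK c.2)
    have d' : S c = 0 := by
      change sec (e (F.rangeRestrict c)) = 0
      rw [d, map_zero, map_zero]
    rw [hE, a, b, d']
    simp
  have hGE : ∀ v, G (E v) = E (F v) := by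
    intro v
    have a : G (k (pC v)) = 0 := hDK (k (pC v)).2
    rw [hE, map_add, map_add, map_sub, hS, hS, a, he]
    have b : E (F v) = e (F.rangeRestrict v) := hER (F.rangeRestrict v)
    rw [b]
    change (e (F.rangeRestrict v) : V') + ((e (F.rangeRestrict (pR v)) : V') -
      (e (F.rangeRestrict (pR v)) : V')) + 0 = _
    rw [sub_self, add_zero, add_zero]
  refine ⟨E, ?_, hGE⟩
  rw [injective_iff_map_eq_zero]
  intro v hv
  -- If `E v = 0` then `e (F v) = 0`, so `v` lies in `ker F`, the direct sum of `ker F ⊓ Im F` and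
  -- `C`. There `E` is `e` plus `k`, whose values are in `Im G` and in `D`; these meet only in zero.
  have hFv : F v ∈ F.range := ⟨v, rfl⟩
  have hK : v ∈ LinearMap.ker F := by
    have a : E (F v) = 0 := by rw [← hGE, hv, map_zero]
    have b := hER ⟨F v, hFv⟩
    rw [a] at b
    have c : e ⟨F v, hFv⟩ = 0 := Subtype.ext b.symm
    rw [LinearEquiv.map_eq_zero_iff] at c
    exact congrArg Subtype.val c
  rw [← hC'] at hK
  obtain ⟨x, ⟨hx, hx'⟩, y, hy, rfl⟩ := Submodule.mem_sup.1 hK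
  rw [map_add, hER ⟨x, hx'⟩, hEC ⟨y, hy⟩] at hv
  have a : (k ⟨y, hy⟩ : V') = 0 := by
    refine Submodule.disjoint_def.1 hD _ ⟨hDK (k ⟨y, hy⟩).2, ?_⟩ (k ⟨y, hy⟩).2
    rw [eq_neg_of_add_eq_zero_right hv]
    exact neg_mem (e ⟨x, hx'⟩).2
  rw [a, add_zero] at hv
  have b : k ⟨y, hy⟩ = 0 := Subtype.ext a
  have c : e ⟨x, hx'⟩ = 0 := Subtype.ext hv
  rw [LinearEquiv.map_eq_zero_iff] at b c
  have b' : y = 0 := congrArg Subtype.val b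
  have c' : x = 0 := congrArg Subtype.val c
  rw [b', c', add_zero]

/-- `ker F²` is the preimage of `ker F` under `F`. This turns the intersection condition of
`exists_injective_extension` into one on kernel dimensions. -/
theorem finrank_ker_inf_range [FiniteDimensional ℂ V] (F : End ℂ V) :
    finrank ℂ (LinearMap.ker F) + finrank ℂ (LinearMap.ker F ⊓ F.range : Submodule ℂ V) =
      finrank ℂ (LinearMap.ker (F ^ 2)) := by
  rw [← finrank_comap_eq, pow_two]
  rfl

theorem range_sub_smul_invariant (f : End ℂ V) (μ : ℂ) :
    ∀ v ∈ (f - μ • 1).range, f v ∈ (f - μ • 1).range := by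
  rintro _ ⟨v, rfl⟩
  exact ⟨f v, by simp⟩

/-- Endomorphisms `f`, `g` with `dim ker (f - μ)^k = dim ker (g - μ)^k` for all `μ`, `k` are
similar. -/
theorem exists_conj_of_finrank_ker_eq [FiniteDimensional ℂ V] [FiniteDimensional ℂ V']
    (f : End ℂ V) (g : End ℂ V')
    (h : ∀ (μ : ℂ) (k : ℕ), finrank ℂ (LinearMap.ker ((f - μ • 1) ^ k)) =
      finrank ℂ (LinearMap.ker ((g - μ • 1) ^ k))) :
    ∃ e : V ≃ₗ[ℂ] V', ∀ v, g (e v) = e (f v) := by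
  induction hn : finrank ℂ V using Nat.strong_induction_on generalizing V V' with
  | _ n ih =>
    rcases subsingleton_or_nontrivial V with hV | hV
    · have hV' : Subsingleton V' := by
        by_contra hV'
        rw [not_subsingleton_iff_nontrivial] at hV'
        obtain ⟨μ, hμ⟩ := Module.End.exists_eigenvalue g
        have a := h μ 1
        rw [pow_one, pow_one, finrank_zero_of_subsingleton] at a
        obtain ⟨v, hv, hv'⟩ := hμ.exists_hasEigenvector
        refine hv' ((Submodule.eq_bot_iff _).1 (Submodule.finrank_eq_zero.1 a.symm) v ?_)
        simpa [sub_eq_zero] using hv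
      exact ⟨0, fun v => Subsingleton.elim _ _⟩
    · obtain ⟨μ, hμ⟩ := Module.End.exists_eigenvalue f
      obtain ⟨v, hv, hv'⟩ := hμ.exists_hasEigenvector
      have hv1 : v ∈ LinearMap.ker (f - μ • 1) := by simpa [sub_eq_zero] using hv
      have hker : 0 < finrank ℂ (LinearMap.ker (f - μ • 1)) := by
        rw [Module.finrank_pos_iff]
        exact ⟨⟨⟨v, hv1⟩, 0, fun hh => hv' (congrArg Subtype.val hh)⟩⟩
      have h1 : finrank ℂ (LinearMap.ker (f - μ • 1)) = finrank ℂ (LinearMap.ker (g - μ • 1)) := by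
        have a := h μ 1
        rwa [pow_one, pow_one] at a
      have hfr := (f - μ • 1).finrank_range_add_finrank_ker
      have hgr := (g - μ • 1).finrank_range_add_finrank_ker
      -- The induction descends to `Im (f - μ)` for an eigenvalue `μ` of `f`, which is strictly
      -- smaller. At `μ` the kernel dimensions of the restrictions are those of `f` and `g` shifted
      -- by one in `k`; at other eigenvalues they are unchanged.
      let f' := f.restrict (range_sub_smul_invariant f μ)
      let g' := g.restrict (range_sub_smul_invariant g μ)
      have hf1 : ∀ k, _ := finrank_ker_pow_succ (f := f) (g := f') (ρ := μ) (f - μ • 1).range.subtype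
        (Submodule.subtype_injective _) (Submodule.range_subtype _) (fun w => rfl)
      have hg1 : ∀ k, _ := finrank_ker_pow_succ (f := g) (g := g') (ρ := μ) (g - μ • 1).range.subtype
        (Submodule.subtype_injective _) (Submodule.range_subtype _) (fun w => rfl)
      obtain ⟨e, he⟩ := ih _ (by omega) f' g' (by
        intro ν k
        by_cases hν : ν = μ
        · subst hν
          have a := hf1 k
          have b := hg1 k
          have c := h ν (k + 1)
          omega
        · rw [← finrank_ker_pow_of_ne (f := f) (g := f') (ρ := μ) (f - μ • 1).range.subtype
            (Submodule.subtype_injective _) (Submodule.range_subtype _) (fun w => rfl) hν,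
            ← finrank_ker_pow_of_ne (f := g) (g := g') (ρ := μ) (g - μ • 1).range.subtype
            (Submodule.subtype_injective _) (Submodule.range_subtype _) (fun w => rfl) hν, h]) rfl
      obtain ⟨E, hE, hE'⟩ := exists_injective_extension (f - μ • 1) (g - μ • 1) e
        (by
          intro w
          have a := congrArg Subtype.val (he w)
          have b : (⟨(f - μ • 1) w, w, rfl⟩ : (f - μ • 1).range) = f' w - μ • w := by
            ext; simp [f']
          rw [b, map_sub, ← he, map_smul]
          simp [g'])
        h1
        (by
          have a := finrank_ker_inf_range (f - μ • 1)
          have b := finrank_ker_inf_range (g - μ • 1)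
          have c := h μ 2
          omega)
      have hdim : finrank ℂ V = finrank ℂ V' := by
        have := e.finrank_eq
        omega
      refine ⟨E.linearEquivOfInjective hE hdim, fun v => ?_⟩
      have a := hE' v
      simp only [LinearMap.sub_apply, map_sub, LinearMap.smul_apply, End.one_apply, map_smul] at a
      exact sub_left_injective a

end LinearAlgebra
end Okubo

/-! ### Columns, kernel dimensions and peeling off the largest multiplicity -/

namespace Okubo

open Module

/-- The multiplicities of the eigenvalue `μ` in a column, in weakly decreasing order. -/
noncomputable def Column.mults (c : Column) (μ : ℂ) : List ℕ :=
  ((c.filter fun x => x.1 = μ).map Prod.snd).insertionSort (fun a b => b ≤ a)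

/-- The kernel dimensions of the powers of `f - μ` are those of the normal form `L` of `c`. -/
def HasKerDims {V : Type*} [AddCommGroup V] [Module ℂ V] (f : End ℂ V) (c : Column) : Prop :=
  ∀ (μ : ℂ) (k : ℕ), finrank ℂ (LinearMap.ker ((f - μ • 1) ^ k)) = ((c.mults μ).take k).sum

theorem Column.mults_cons_self {c : Column} {ρ : ℂ} {m : ℕ} (h : ∀ x ∈ c, x.1 = ρ → x.2 ≤ m) :
    Column.mults ((ρ, m) :: c) ρ = m :: c.mults ρ := by
  unfold Column.mults
  simp only [decide_true, List.filter_cons_of_pos, List.map_cons, List.insertionSort_cons]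
  generalize hl : List.insertionSort (fun a b : ℕ => b ≤ a)
    ((c.filter fun x => x.1 = ρ).map Prod.snd) = l
  cases l with
  | nil => rfl
  | cons b l =>
    refine List.orderedInsert_cons_of_le _ _ ?_
    have hb : b ∈ List.insertionSort (fun a b : ℕ => b ≤ a)
        ((c.filter fun x => x.1 = ρ).map Prod.snd) := by rw [hl]; exact List.mem_cons_self
    rw [List.mem_insertionSort] at hb
    simp only [List.mem_map, List.mem_filter, decide_eq_true_eq] at hb
    obtain ⟨x, ⟨hx, hx'⟩, rfl⟩ := hb
    exact h x hx hx'

theorem Column.mults_cons_of_ne {c : Column} {ρ μ : ℂ} {m : ℕ} (h : ρ ≠ μ) :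
    Column.mults ((ρ, m) :: c) μ = c.mults μ := by
  unfold Column.mults
  rw [List.filter_cons_of_neg (by simpa using h)]

theorem Column.mults_perm {c c' : Column} (h : c.Perm c') (μ : ℂ) : c.mults μ = c'.mults μ := by
  refine List.Perm.eq_of_pairwise (le := fun a b : ℕ => b ≤ a) (fun a b _ _ h1 h2 => le_antisymm h2 h1)
    (List.pairwise_insertionSort _ _) (List.pairwise_insertionSort _ _) ?_
  exact (List.perm_insertionSort _ _).trans
    (((h.filter _).map _).trans (List.perm_insertionSort _ _).symm)

theorem Column.mults_map_sub (c : Column) (σ μ : ℂ) :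
    Column.mults (c.map fun x => (σ - x.1, x.2)) μ = c.mults (σ - μ) := by
  unfold Column.mults
  rw [List.filter_map, List.map_map]
  congr 2
  refine List.filter_congr fun x _ => ?_
  simp only [Function.comp_apply, decide_eq_decide]
  exact ⟨fun h => by rw [← h]; ring, fun h => by rw [h]; ring⟩

theorem Column.mem_mults {c : Column} {μ : ℂ} {m : ℕ} (h : (μ, m) ∈ c) : m ∈ c.mults μ := by
  unfold Column.mults
  rw [List.mem_insertionSort]
  simp only [List.mem_map, List.mem_filter, decide_eq_true_eq]
  exact ⟨(μ, m), ⟨h, rfl⟩, rfl⟩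

section

variable {V W : Type*} [AddCommGroup V] [Module ℂ V] [AddCommGroup W] [Module ℂ W]

/-- Maximality of `m` puts it first among the multiplicities of `ρ`, so the partial sums at `ρ` obey
the same recursion as the kernel dimensions in `finrank_ker_pow_succ`; at the other eigenvalues
neither side changes. All columns below are obtained by applying this equivalence in one direction
or the other. -/
theorem HasKerDims.cons_iff [FiniteDimensional ℂ V] {f : End ℂ V} {g : End ℂ W} {ρ : ℂ} {m : ℕ}
    {c : Column} (hm : ∀ x ∈ c, x.1 = ρ → x.2 ≤ m)
    (ι : W →ₗ[ℂ] V) (hι : Function.Injective ι) (hr : ι.range = (f - ρ • 1).range)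
    (hc : ∀ w, f (ι w) = ι (g w)) :
    HasKerDims f ((ρ, m) :: c) ↔ finrank ℂ (LinearMap.ker (f - ρ • 1)) = m ∧ HasKerDims g c := by
  constructor
  · intro h
    have h1 : finrank ℂ (LinearMap.ker (f - ρ • 1)) = m := by
      have a := h ρ 1
      rwa [Column.mults_cons_self hm, List.take_succ_cons, List.take_zero, List.sum_singleton,
        pow_one] at a
    refine ⟨h1, fun μ k => ?_⟩
    by_cases hμ : μ = ρ
    · subst hμ
      have a := h μ (k + 1)
      rw [finrank_ker_pow_succ ι hι hr hc, h1, Column.mults_cons_self hm, List.take_succ_cons,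
        List.sum_cons] at a
      exact Nat.add_left_cancel a
    · rw [← finrank_ker_pow_of_ne ι hι hr hc hμ, h, Column.mults_cons_of_ne (Ne.symm hμ)]
  · rintro ⟨h1, h⟩ μ k
    by_cases hμ : μ = ρ
    · subst hμ
      cases k with
      | zero =>
        rw [pow_zero, List.take_zero, List.sum_nil, End.one_eq_id, LinearMap.ker_id, finrank_bot]
      | succ k =>
        rw [finrank_ker_pow_succ ι hι hr hc, h1, Column.mults_cons_self hm, List.take_succ_cons,
          List.sum_cons, h]
    · rw [finrank_ker_pow_of_ne ι hι hr hc hμ, h, Column.mults_cons_of_ne (Ne.symm hμ)]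

theorem HasKerDims.nil [Subsingleton V] (f : End ℂ V) : HasKerDims f [] := fun μ k => by
  rw [finrank_zero_of_subsingleton]; simp [Column.mults]

theorem HasKerDims.perm {f : End ℂ V} {c c' : Column} (h : HasKerDims f c) (hc : c.Perm c') :
    HasKerDims f c' := fun μ k => by rw [← Column.mults_perm hc]; exact h μ k

theorem HasKerDims.conj {f : End ℂ V} {g : End ℂ W} {c : Column} (h : HasKerDims f c)
    (e : V ≃ₗ[ℂ] W) (he : ∀ v, g (e v) = e (f v)) : HasKerDims g c := fun μ k => by
  have a := ker_pow_inf_range_eq_map (f := g) (g := f) e.toLinearMap e.injective he μ k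
  rw [LinearEquiv.range, inf_top_eq] at a
  rw [a, ← (Submodule.equivMapOfInjective _ e.injective _).finrank_eq, h]

theorem HasKerDims.smul_one_sub {f : End ℂ V} {c : Column} (h : HasKerDims f c) (σ : ℂ) :
    HasKerDims (σ • 1 - f) (c.map fun x => (σ - x.1, x.2)) := fun μ k => by
  have a : (σ • 1 - f) - μ • 1 = -(f - (σ - μ) • 1) := by rw [sub_smul]; abel
  have b : LinearMap.ker ((-(f - (σ - μ) • 1)) ^ k) = LinearMap.ker ((f - (σ - μ) • 1) ^ k) := by
    rcases Nat.even_or_odd k with hk | hk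
    · rw [hk.neg_pow]
    · rw [hk.neg_pow]
      ext v
      simp
  rw [a, b, Column.mults_map_sub, h]

/-- The case `k = 1` says that the largest multiplicity is the dimension of the eigenspace. This
supplies the maximality hypothesis of `HasKerDims.cons_iff`. -/
theorem HasKerDims.le_finrank_ker {f : End ℂ V} {c : Column} (h : HasKerDims f c) {x : ℂ × ℕ}
    (hx : x ∈ c) : x.2 ≤ finrank ℂ (LinearMap.ker (f - x.1 • 1)) := by
  have a := h x.1 1
  have b : x.2 ∈ c.mults x.1 := Column.mem_mults hx
  have d : (c.mults x.1).Pairwise (fun a b => b ≤ a) := List.pairwise_insertionSort _ _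
  rw [pow_one] at a
  rw [a]
  generalize c.mults x.1 = l at b d
  cases l with
  | nil => cases b
  | cons m l =>
    rw [List.take_succ_cons, List.take_zero, List.sum_singleton]
    rcases List.mem_cons.1 b with b | b
    · exact b.le
    · exact (List.pairwise_cons.1 d).1 _ b

theorem hasKerDims_singleton [FiniteDimensional ℂ V] {f : End ℂ V} {ρ : ℂ}
    (h : ∀ v, f v = ρ • v) : HasKerDims f [(ρ, finrank ℂ V)] := by
  have h0 : f - ρ • 1 = 0 := LinearMap.ext fun v => by simp [h]
  refine (HasKerDims.cons_iff (g := (0 : End ℂ (⊥ : Submodule ℂ V))) (by simp)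
    (⊥ : Submodule ℂ V).subtype (Submodule.subtype_injective _) ?_ ?_).2 ⟨?_, HasKerDims.nil _⟩
  · rw [h0, LinearMap.range_zero, Submodule.range_subtype]
  · rintro ⟨w, hw⟩
    have hw' : w = 0 := hw
    subst hw'
    simp
  · rw [h0, LinearMap.ker_zero, finrank_top]

end

/-! ### Kernel dimensions of the normal form -/

open Matrix

theorem LSorted_mulVec_succ (x : ℂ × ℕ) (c : Column) (u : LIndex (x :: c) → ℂ)
    (i : Fin c.length) (a : Fin (c.get i).2) :
    (LSorted (x :: c) *ᵥ u) ⟨i.succ, a⟩ =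
      (LSorted c *ᵥ fun y => u ⟨y.1.succ, y.2⟩) ⟨i, a⟩ := by
  simp only [Matrix.mulVec, dotProduct]
  rw [Fintype.sum_sigma, Fintype.sum_sigma]
  refine (Fin.sum_univ_succ _).trans ?_
  rw [Finset.sum_eq_zero, zero_add]
  · refine Finset.sum_congr rfl fun j _ => Finset.sum_congr rfl fun b _ => ?_
    congr 1
    simp [LSorted]
  · intro b _
    simp [LSorted, Fin.succ_ne_zero]

/-- The sum is the block `(I; 0)` applied to the first block of the tail. It is written over all of
`LIndex c` so that an empty `c` needs no separate treatment. -/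
theorem LSorted_mulVec_zero (x : ℂ × ℕ) (c : Column) (u : LIndex (x :: c) → ℂ)
    (a : Fin x.2) :
    (LSorted (x :: c) *ᵥ u) ⟨⟨0, Nat.succ_pos _⟩, a⟩ = x.1 * u ⟨⟨0, Nat.succ_pos _⟩, a⟩ +
      ∑ y : LIndex c, if (y.1 : ℕ) = 0 ∧ (y.2 : ℕ) = a then u ⟨y.1.succ, y.2⟩ else 0 := by
  simp only [Matrix.mulVec, dotProduct]
  rw [Fintype.sum_sigma, Fintype.sum_sigma]
  refine (Fin.sum_univ_succ _).trans ?_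
  congr 1
  · refine (Finset.sum_eq_single a ?_ fun h => absurd (Finset.mem_univ _) h).trans ?_
    rotate_left
    · simp [LSorted]
    · intro b _ hb
      have : ¬ (a : ℕ) = b := fun h => hb (Fin.ext h.symm)
      simp [LSorted, this]
  · refine Finset.sum_congr rfl fun j _ => Finset.sum_congr rfl fun b _ => ?_
    have h0 : ¬ (0 : Fin (c.length + 1)) = j.succ := (Fin.succ_ne_zero j).symm
    by_cases h1 : (j : ℕ) = 0
    · by_cases h2 : (a : ℕ) = b
      · simp [LSorted, h1, h2]
        exact fun h => absurd h h0
      · simp [LSorted, h1, h2, Ne.symm h2]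
    · simp [LSorted, h1]
      exact fun h => absurd h h0

theorem sum_first_block {c : Column} (w : LIndex c → ℂ) (y : LIndex c) (hy : (y.1 : ℕ) = 0) :
    (∑ z : LIndex c, if (z.1 : ℕ) = 0 ∧ (z.2 : ℕ) = y.2 then w z else 0) = w y := by
  rw [Finset.sum_eq_single y]
  · simp [hy]
  · rintro ⟨i, a⟩ _ hz
    refine if_neg ?_
    rintro ⟨h1, h2⟩
    obtain ⟨j, b⟩ := y
    have hij : i = j := Fin.ext (h1.trans hy.symm)
    subst hij
    exact hz (congrArg (Sigma.mk i) (Fin.ext h2))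
  · simp

/-- An eigenvector of `L` whose first block vanishes is zero. -/
theorem eq_zero_of_LSorted_mulVec {c : Column} (hc : c.Pairwise fun a b => b.2 ≤ a.2) (τ : ℂ)
    (v : LIndex c → ℂ) (hv : LSorted c *ᵥ v = τ • v) (h0 : ∀ y : LIndex c, (y.1 : ℕ) = 0 → v y = 0) :
    v = 0 := by
  induction c with
  | nil => ext ⟨i, _⟩; exact i.elim0
  | cons x c ih =>
    rw [List.pairwise_cons] at hc
    have hw : (fun y : LIndex c => v ⟨y.1.succ, y.2⟩) = 0 := by
      refine ih hc.2 _ ?_ ?_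
      · ext ⟨i, a⟩
        rw [← LSorted_mulVec_succ x c v i a, hv]
        rfl
      · intro y hy
        have hle : (c.get y.1).2 ≤ x.2 := hc.1 _ (List.get_mem _ _)
        have a := LSorted_mulVec_zero x c v ⟨y.2, y.2.2.trans_le hle⟩
        rw [hv, Pi.smul_apply, h0 _ rfl, mul_zero, zero_add, smul_zero] at a
        exact (sum_first_block (fun y : LIndex c => v ⟨y.1.succ, y.2⟩) y hy).symm.trans a.symm
    ext ⟨i, a⟩
    revert a
    refine Fin.cases (fun a => h0 _ rfl) (fun j a => ?_) i
    exact congrFun hw ⟨j, a⟩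

theorem card_LIndex_cons (x : ℂ × ℕ) (c : Column) :
    Fintype.card (LIndex (x :: c)) = x.2 + Fintype.card (LIndex c) := by
  rw [Fintype.card_sigma, Fintype.card_sigma]
  refine (Fin.sum_univ_succ _).trans ?_
  simp only [Fintype.card_fin]
  rfl

/-- Extension by zero from the blocks of `c` to those of `x :: c`. -/
def extendLIndex (x : ℂ × ℕ) (c : Column) : (LIndex c → ℂ) →ₗ[ℂ] (LIndex (x :: c) → ℂ) where
  toFun w y := Fin.cases (motive := fun i : Fin (c.length + 1) => Fin ((x :: c).get i).2 → ℂ)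
    (fun _ => 0) (fun j a => w ⟨j, a⟩) y.1 y.2
  map_add' w w' := by
    ext ⟨i, a⟩
    revert a
    refine Fin.cases (fun a => ?_) (fun j a => ?_) i
    · exact (add_zero _).symm
    · rfl
  map_smul' r w := by
    ext ⟨i, a⟩
    revert a
    refine Fin.cases (fun a => ?_) (fun j a => ?_) i
    · exact (smul_zero r).symm
    · rfl

/-- `L - ρ` kills the vectors supported in the first block, so its image is already that of the
vectors supported in the tail. On those it is injective by `eq_zero_of_LSorted_mulVec`, where the
decreasing order is needed, and it intertwines `L` with the normal form of the tail. -/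
theorem hasKerDims_LSorted (c : Column) (hc : c.Pairwise fun a b => b.2 ≤ a.2) :
    HasKerDims (Matrix.toLin' (LSorted c)) c := by
  induction c with
  | nil =>
    have : Subsingleton (LIndex [] → ℂ) := ⟨fun u v => funext fun y => y.1.elim0⟩
    exact HasKerDims.nil _
  | cons x c ih =>
    obtain ⟨ρ, m⟩ := x
    rw [List.pairwise_cons] at hc
    set f := Matrix.toLin' (LSorted ((ρ, m) :: c)) with hf
    set g := Matrix.toLin' (LSorted c) with hg
    let ι : (LIndex c → ℂ) →ₗ[ℂ] (LIndex ((ρ, m) :: c) → ℂ) := (f - ρ • 1) ∘ₗ extendLIndex (ρ, m) c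
    have hfs : ∀ u i a, f u ⟨i.succ, a⟩ = g (fun y => u ⟨y.1.succ, y.2⟩) ⟨i, a⟩ := by
      intro u i a
      rw [hf, hg, Matrix.toLin'_apply, Matrix.toLin'_apply]
      exact LSorted_mulVec_succ _ c u i a
    have hf0 : ∀ u a, f u ⟨⟨0, Nat.succ_pos _⟩, a⟩ = ρ * u ⟨⟨0, Nat.succ_pos _⟩, a⟩ +
      ∑ y : LIndex c, if (y.1 : ℕ) = 0 ∧ (y.2 : ℕ) = a then u ⟨y.1.succ, y.2⟩ else 0 := by
      intro u a
      rw [hf, Matrix.toLin'_apply]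
      exact LSorted_mulVec_zero _ c u a
    have hker : ∀ u : LIndex ((ρ, m) :: c) → ℂ, (∀ y : LIndex c, u ⟨y.1.succ, y.2⟩ = 0) →
        (f - ρ • 1) u = 0 := by
      intro u hu
      rw [LinearMap.sub_apply, sub_eq_zero]
      ext ⟨i, a⟩
      revert a
      refine Fin.cases (fun a => ?_) (fun j a => ?_) i
      · refine (hf0 u a).trans ?_
        rw [Finset.sum_eq_zero fun y _ => by rw [hu, ite_self], add_zero]
        rfl
      · rw [hfs, show (fun y : LIndex c => u ⟨y.1.succ, y.2⟩) = 0 from funext hu, map_zero]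
        exact ((congrArg (ρ * ·) (hu ⟨j, a⟩)).trans (mul_zero ρ)).symm
    have hι : Function.Injective ι := by
      rw [injective_iff_map_eq_zero]
      intro w hw
      have hw' : f (extendLIndex (ρ, m) c w) = ρ • extendLIndex (ρ, m) c w := sub_eq_zero.1 hw
      refine eq_zero_of_LSorted_mulVec hc.2 ρ w ?_ ?_
      · ext ⟨i, a⟩
        have h1 := congrFun hw' ⟨i.succ, a⟩
        rw [hfs] at h1
        exact h1
      · intro y hy
        have hle : (c.get y.1).2 ≤ m := hc.1 _ (List.get_mem _ _)
        have a := hf0 (extendLIndex (ρ, m) c w) ⟨y.2, y.2.2.trans_le hle⟩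
        rw [hw'] at a
        have b := left_eq_add.1 a
        exact (sum_first_block w y hy).symm.trans b
    have hr : ι.range = (f - ρ • 1).range := by
      refine le_antisymm (LinearMap.range_comp_le_range _ _) ?_
      rintro _ ⟨u, rfl⟩
      refine ⟨fun y => u ⟨y.1.succ, y.2⟩, ?_⟩
      have a := hker (extendLIndex (ρ, m) c (fun y => u ⟨y.1.succ, y.2⟩) - u) (fun y => sub_self _)
      rw [map_sub, sub_eq_zero] at a
      exact a
    have hcomm : ∀ w, f (ι w) = ι (g w) := by
      intro w
      have a : f (ι w) = (f - ρ • 1) (f (extendLIndex (ρ, m) c w)) := by simp [ι]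
      rw [a, ← sub_eq_zero]
      change (f - ρ • 1) _ - (f - ρ • 1) _ = 0
      rw [← map_sub]
      refine hker _ fun y => ?_
      rw [Pi.sub_apply, hfs]
      exact sub_self _
    refine (HasKerDims.cons_iff (fun x hx _ => hc.1 x hx) ι hι hr hcomm).2 ⟨?_, ih hc.2⟩
    have h1 := (f - ρ • 1).finrank_range_add_finrank_ker
    rw [← hr, LinearMap.finrank_range_of_inj hι, Module.finrank_fintype_fun_eq_card,
      Module.finrank_fintype_fun_eq_card, card_LIndex_cons] at h1
    exact Nat.add_left_cancel (h1.trans (Nat.add_comm _ _))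

theorem Column.sorted_perm (c : Column) : c.sorted.Perm c := List.perm_insertionSort _ _

theorem Column.pairwise_sorted (c : Column) : c.sorted.Pairwise fun a b => b.2 ≤ a.2 := by
  have : Std.Total (fun a b : ℂ × ℕ => b.2 ≤ a.2) := ⟨fun a b => le_total _ _⟩
  have : IsTrans (ℂ × ℕ) (fun a b => b.2 ≤ a.2) := ⟨fun a b c h1 h2 => le_trans h2 h1⟩
  exact List.pairwise_insertionSort _ _

/-- The similarity class of the normal form `L` of a column is characterized by the dimensions of
the kernels of the powers of `f - μ`. -/
theorem isSimilarToL_iff_hasKerDims {V : Type*} [AddCommGroup V] [Module ℂ V]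
    [FiniteDimensional ℂ V] (f : End ℂ V) (c : Column) : IsSimilarToL f c ↔ HasKerDims f c := by
  have hL := (hasKerDims_LSorted _ c.pairwise_sorted).perm c.sorted_perm
  constructor
  · rintro ⟨b, hb⟩
    refine hL.conj b.equivFun.symm fun v => ?_
    rw [← hb, LinearEquiv.eq_symm_apply, Matrix.toLin'_apply]
    have a := LinearMap.toMatrix_mulVec_repr b b f (b.equivFun.symm v)
    rw [← b.equivFun_apply, ← b.equivFun_apply, LinearEquiv.apply_symm_apply] at a
    exact a.symm
  · intro h
    obtain ⟨e, he⟩ := exists_conj_of_finrank_ker_eq (Matrix.toLin' (LSorted c.sorted)) f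
      fun μ k => (hL μ k).trans (h μ k).symm
    refine ⟨(Pi.basisFun ℂ _).map e, ?_⟩
    ext x y
    rw [LinearMap.toMatrix_apply, Basis.map_apply, Basis.map_repr, he]
    simp

end Okubo

/-! ### Block projections, rank conditions and the extended system -/

namespace Okubo

open Module

namespace System

variable {p : ℕ} (S : System p)

/-- The block projection `diag(0, …, 0, I_{n_j}, 0, …, 0)` as an endomorphism of `ℂⁿ`. -/
noncomputable def proj (j : Fin p) : End ℂ S.Space := Matrix.toLin' (S.blockProj j)

theorem proj_apply (j : Fin p) (v : S.Space) (x : Σ j, Fin (S.n j)) :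
    S.proj j v x = if x.1 = j then v x else 0 := by
  rw [proj, blockProj, Matrix.toLin'_apply, Matrix.mulVec_diagonal]
  split_ifs <;> simp

theorem proj_proj_self (j : Fin p) (v : S.Space) : S.proj j (S.proj j v) = S.proj j v := by
  ext x
  simp only [proj_apply]
  split_ifs <;> rfl

theorem proj_proj_of_ne {i j : Fin p} (h : i ≠ j) (v : S.Space) :
    S.proj j (S.proj i v) = 0 := by
  ext x
  simp only [proj_apply]
  split_ifs with h1 h2
  · exact absurd (h2.symm.trans h1) h
  all_goals rfl

theorem sum_proj_apply (v : S.Space) : ∑ j, S.proj j v = v := by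
  ext x
  rw [Finset.sum_apply]
  simp [proj_apply]

theorem proj_sum_proj (j : Fin p) (u : Fin p → S.Space) :
    S.proj j (∑ i, S.proj i (u i)) = S.proj j (u j) := by
  rw [map_sum, Finset.sum_eq_single j (fun i _ h => S.proj_proj_of_ne h _) (by simp),
    proj_proj_self]

theorem residue_apply (j : Fin p) (v : S.Space) : S.residue j v = S.proj j (S.endA v) := by
  rw [residue, Matrix.toLin'_mul]; rfl

theorem sum_residue : ∑ j, S.residue j = S.endA := by
  refine LinearMap.ext fun v => ?_
  rw [LinearMap.sum_apply]
  simp only [residue_apply, sum_proj_apply]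

theorem toLin'_T_apply (v : S.Space) : Matrix.toLin' S.T v = ∑ j, S.t j • S.proj j v := by
  ext x
  rw [T, Matrix.toLin'_apply, Matrix.mulVec_diagonal, Finset.sum_apply]
  simp [proj_apply]

theorem finrank_range_proj (j : Fin p) : finrank ℂ (S.proj j).range = S.n j := by
  have h : (S.blockProj j).rank = finrank ℂ (S.proj j).range := by
    rw [Matrix.rank, ← Matrix.toLin'_apply']; rfl
  rw [← h, blockProj, Matrix.rank_diagonal]
  have e : {x : Σ j, Fin (S.n j) // (if x.1 = j then (1 : ℂ) else 0) ≠ 0} ≃ Fin (S.n j) :=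
    (Equiv.subtypeEquivRight (q := fun x => x.1 = j) fun x => by simp).trans (Equiv.sigmaSubtype j)
  rw [Fintype.card_congr e, Fintype.card_fin]

theorem finrank_space : finrank ℂ S.Space = S.rank := by
  rw [Module.finrank_fintype_fun_eq_card, Fintype.card_sigma]
  simp [rank]

/-- A coordinate-free form: since `Im P_j` has dimension `n_j`, the rank equalities mean that `A +
τ` is injective on `Im P_j` and that `P_j (A + τ)` maps onto it. -/
theorem rank_conditions_iff : S.RankConditions ↔ Function.Injective S.endA ∧
    ∀ (τ : ℂ) (j : Fin p),
      (∀ v, (S.endA + τ • 1) (S.proj j v) = 0 → S.proj j v = 0) ∧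
      ∀ v, ∃ u, S.proj j ((S.endA + τ • 1) u) = S.proj j v := by
  have hrank : ∀ M : Matrix (Σ j, Fin (S.n j)) (Σ j, Fin (S.n j)) ℂ,
      M.rank = finrank ℂ (Matrix.toLin' M).range := fun M => by
    rw [Matrix.rank, ← Matrix.toLin'_apply']
  have hA : ∀ τ : ℂ, Matrix.toLin' (S.A + τ • (1 : Matrix _ _ ℂ)) = S.endA + τ • 1 := fun τ => by
    rw [map_add, map_smul, Matrix.toLin'_one]; rfl
  refine and_congr ?_ (forall_congr' fun τ => forall_congr' fun j => and_congr ?_ ?_)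
  · rw [hrank, ← S.finrank_space]
    constructor
    · intro h
      exact LinearMap.injective_iff_surjective.2
        (LinearMap.range_eq_top.1 (Submodule.eq_top_of_finrank_eq h))
    · exact fun h => LinearMap.finrank_range_of_inj h
  · rw [hrank, Matrix.toLin'_mul, hA]
    change finrank ℂ ((S.endA + τ • 1) ∘ₗ S.proj j).range = _ ↔ _
    rw [LinearMap.range_comp, ← S.finrank_range_proj j]
    have h1 : (Submodule.map (S.endA + τ • 1) (S.proj j).range) =
      ((S.endA + τ • 1).domRestrict (S.proj j).range).range := (LinearMap.range_domRestrict _ _).symm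
    have h2 := ((S.endA + τ • 1).domRestrict (S.proj j).range).finrank_range_add_finrank_ker
    rw [h1]
    have h3 : finrank ℂ ((S.endA + τ • 1).domRestrict (S.proj j).range).range =
      finrank ℂ (S.proj j).range ↔ finrank ℂ ((S.endA + τ • 1).domRestrict (S.proj j).range).ker = 0 := by
      omega
    rw [h3, Submodule.finrank_eq_zero, LinearMap.ker_eq_bot']
    constructor
    · intro h v hv
      exact congrArg Subtype.val (h ⟨S.proj j v, v, rfl⟩ hv)
    · rintro h ⟨_, v, rfl⟩ hv
      exact Subtype.ext (h v hv)
  · rw [hrank, Matrix.toLin'_mul, hA]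
    change finrank ℂ (S.proj j ∘ₗ (S.endA + τ • 1)).range = _ ↔ _
    rw [← S.finrank_range_proj j]
    constructor
    · intro h v
      have h1 := Submodule.eq_of_le_of_finrank_eq (LinearMap.range_comp_le_range _ _) h
      have h2 : S.proj j v ∈ (S.proj j).range := ⟨v, rfl⟩
      rw [← h1] at h2
      exact h2
    · intro h
      have h1 : (S.proj j ∘ₗ (S.endA + τ • 1)).range = (S.proj j).range := by
        refine le_antisymm (LinearMap.range_comp_le_range _ _) ?_
        rintro _ ⟨v, rfl⟩
        exact h v
      rw [h1]

/-- When `A` is invertible, common invariant subspaces of the residues are those of `A` and the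
block projections. -/
theorem isLinearlyIrreducible_iff (hA : Function.Injective S.endA) :
    IsLinearlyIrreducible S.residue ↔ ∀ U : Submodule ℂ S.Space, (∀ u ∈ U, S.endA u ∈ U) →
      (∀ j, ∀ u ∈ U, S.proj j u ∈ U) → U = ⊥ ∨ U = ⊤ := by
  constructor
  · intro h U h1 h2
    exact h U fun j u hu => by rw [residue_apply]; exact h2 j _ (h1 u hu)
  · intro h U hU
    have h1 : ∀ u ∈ U, S.endA u ∈ U := fun u hu => by
      rw [← sum_residue, LinearMap.sum_apply]
      exact Submodule.sum_mem _ fun j _ => hU j u hu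
    refine h U h1 fun j u hu => ?_
    -- `A` is injective, hence maps the invariant subspace `U` onto itself. Every `u` in `U` is
    -- therefore `A w` with `w` in `U`, and `P_j u = A_j w`.
    have h2 : U.map S.endA = U := Submodule.eq_of_le_of_finrank_eq
      (Submodule.map_le_iff_le_comap.2 h1) (Submodule.equivMapOfInjective _ hA U).finrank_eq.symm
    rw [← h2] at hu
    obtain ⟨w, hw, rfl⟩ := hu
    rw [← residue_apply]
    exact hU j w hw

variable (ρ₁ ρ₂ : ℂ)

theorem quad_apply (v : S.Space) :
    S.quad ρ₁ ρ₂ v = (S.endA - ρ₁ • 1) ((S.endA - ρ₂ • 1) v) := rfl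

theorem quad_apply' (v : S.Space) :
    S.quad ρ₁ ρ₂ v = (S.endA - ρ₂ • 1) ((S.endA - ρ₁ • 1) v) := by
  rw [quad_apply]
  simp only [LinearMap.sub_apply, LinearMap.smul_apply, End.one_apply, map_sub, map_smul]
  module

theorem quad_eq (v : S.Space) :
    S.quad ρ₁ ρ₂ v = S.endA (S.endA v) - (ρ₁ + ρ₂) • S.endA v + (ρ₁ * ρ₂) • v := by
  rw [quad_apply]
  simp only [LinearMap.sub_apply, LinearMap.smul_apply, End.one_apply, map_sub, map_smul]
  module

theorem endA_mem_range_quad : ∀ v ∈ (S.quad ρ₁ ρ₂).range, S.endA v ∈ (S.quad ρ₁ ρ₂).range := by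
  rintro _ ⟨v, rfl⟩
  exact ⟨S.endA v, by simp only [quad_eq, map_add, map_sub, map_smul]⟩

/-- The external direct sum `ℂⁿ ⊕ Im (A - ρ₁)(A - ρ₂)`. -/
abbrev ExtSum : Type := S.Space × (S.quad ρ₁ ρ₂).range

/-- The identification of the internal and the external direct sum. -/
noncomputable def extEquiv : S.extSpace ρ₁ ρ₂ ≃ₗ[ℂ] S.ExtSum ρ₁ ρ₂ where
  toFun x := (x.1.1, ⟨x.1.2, x.2.2⟩)
  invFun y := ⟨(y.1, y.2), Submodule.mem_top, y.2.2⟩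
  map_add' _ _ := rfl
  map_smul' _ _ := rfl

/-- `Â` on the external direct sum. -/
noncomputable def extB : End ℂ (S.ExtSum ρ₁ ρ₂) := (S.extEquiv ρ₁ ρ₂).conj (S.extA ρ₁ ρ₂)

theorem extB_fst (y : S.ExtSum ρ₁ ρ₂) : (S.extB ρ₁ ρ₂ y).1 = S.endA y.1 + y.2 := rfl

theorem extB_snd (y : S.ExtSum ρ₁ ρ₂) : ((S.extB ρ₁ ρ₂ y).2 : S.Space) =
    -S.quad ρ₁ ρ₂ y.1 + (-S.endA y.2 + (ρ₁ + ρ₂) • (y.2 : S.Space)) := rfl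

theorem ExtSum.ext {y z : S.ExtSum ρ₁ ρ₂} (h1 : y.1 = z.1) (h2 : (y.2 : S.Space) = z.2) : y = z :=
  Prod.ext h1 (Subtype.ext h2)

/-- The relation `(Â - ρ₁)(Â - ρ₂) = 0`, for which the lower blocks of `Â` are designed. It gives
both the invertibility of `Â` and its spectrum. -/
theorem extB_extB (y : S.ExtSum ρ₁ ρ₂) : S.extB ρ₁ ρ₂ (S.extB ρ₁ ρ₂ y) =
    (ρ₁ + ρ₂) • S.extB ρ₁ ρ₂ y - (ρ₁ * ρ₂) • y := by
  refine ExtSum.ext _ _ _ ?_ ?_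
  · rw [extB_fst, extB_fst, extB_snd, Prod.fst_sub, Prod.smul_fst, Prod.smul_fst, extB_fst, quad_eq]
    simp only [map_add]
    module
  · rw [extB_snd, Prod.snd_sub, Prod.smul_snd, Prod.smul_snd, Submodule.coe_sub, Submodule.coe_smul,
      Submodule.coe_smul, extB_fst, extB_snd]
    simp only [quad_eq, map_add, map_sub, map_smul, map_neg]
    module

/-- `S'` is the extension of `S` with respect to the identification `e` of its space. -/
structure IsExtension (S' : System (p + 1)) (e : S.ExtSum ρ₁ ρ₂ ≃ₗ[ℂ] S'.Space) : Prop where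
  n_castSucc : ∀ j : Fin p, S'.n j.castSucc = S.n j
  n_last : S'.n (Fin.last p) = finrank ℂ (S.quad ρ₁ ρ₂).range
  proj_castSucc : ∀ j y, S'.proj (Fin.castSucc j) (e y) = e (S.proj j y.1, 0)
  proj_last : ∀ y, S'.proj (Fin.last p) (e y) = e (0, y.2)
  endA : ∀ y, S'.endA (e y) = e (S.extB ρ₁ ρ₂ y)

theorem exists_isExtension (s : ℂ) (hs : ∀ j, s ≠ S.t j) :
    ∃ (S' : System (p + 1)) (e : S.ExtSum ρ₁ ρ₂ ≃ₗ[ℂ] S'.Space),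
      (∀ j : Fin p, S'.t j.castSucc = S.t j) ∧ S'.t (Fin.last p) = s ∧ S.IsExtension ρ₁ ρ₂ S' e := by
  set r := finrank ℂ (S.quad ρ₁ ρ₂).range with hr
  obtain ⟨n, hn, hn'⟩ : ∃ n : Fin (p + 1) → ℕ, (∀ j : Fin p, n j.castSucc = S.n j) ∧
      n (Fin.last p) = r :=
    ⟨Fin.snoc (α := fun _ => ℕ) S.n r, fun j => Fin.snoc_castSucc (α := fun _ => ℕ) _ _ _,
      Fin.snoc_last (α := fun _ => ℕ) _ _⟩
  obtain ⟨t, ht, ht'⟩ : ∃ t : Fin (p + 1) → ℂ, (∀ j : Fin p, t j.castSucc = S.t j) ∧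
      t (Fin.last p) = s :=
    ⟨Fin.snoc (α := fun _ => ℂ) S.t s, fun j => Fin.snoc_castSucc (α := fun _ => ℂ) _ _ _,
      Fin.snoc_last (α := fun _ => ℂ) _ _⟩
  have htinj : Function.Injective t := by
    intro i j
    refine Fin.lastCases ?_ (fun i => ?_) i <;> refine Fin.lastCases ?_ (fun j => ?_) j
    · simp
    · rw [ht, ht']; exact fun h => absurd h (hs j)
    · rw [ht, ht']; exact fun h => absurd h.symm (hs i)
    · rw [ht, ht]; exact fun h => congrArg _ (S.t_injective h)
  let ε : (Σ j, Fin (S.n j)) ⊕ Fin r → Σ j, Fin (n j) :=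
    Sum.elim (fun x => ⟨x.1.castSucc, Fin.cast (hn x.1).symm x.2⟩)
      (fun a => ⟨Fin.last p, Fin.cast hn'.symm a⟩)
  have hε : Function.Bijective ε := by
    constructor
    · rintro (⟨i, a⟩ | a) (⟨j, b⟩ | b) h
      · have h1 : i = j := Fin.castSucc_injective _ (congrArg Sigma.fst h)
        subst h1
        have h2 := eq_of_heq (Sigma.mk.inj h).2
        rw [Fin.cast_inj] at h2
        exact congrArg (fun z => Sum.inl (Sigma.mk i z)) h2
      · exact absurd (congrArg Sigma.fst h) (Fin.castSucc_ne_last i)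
      · exact absurd (congrArg Sigma.fst h).symm (Fin.castSucc_ne_last j)
      · have h2 := eq_of_heq (Sigma.mk.inj h).2
        rw [Fin.cast_inj] at h2
        rw [h2]
    · rintro ⟨j, a⟩
      revert a
      refine Fin.lastCases (fun a => ?_) (fun j a => ?_) j
      · exact ⟨Sum.inr (Fin.cast hn' a), rfl⟩
      · exact ⟨Sum.inl ⟨j, Fin.cast (hn j) a⟩, rfl⟩
  -- Any coordinates on the new summand will do, since `T̂` acts on it as a scalar.
  let β : (S.quad ρ₁ ρ₂).range ≃ₗ[ℂ] (Fin r → ℂ) := LinearEquiv.ofFinrankEq _ _ (by simp [hr])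
  let e : S.ExtSum ρ₁ ρ₂ ≃ₗ[ℂ] ((Σ j, Fin (n j)) → ℂ) :=
    ((LinearEquiv.refl ℂ S.Space).prodCongr β).trans
      ((LinearEquiv.sumArrowLequivProdArrow _ _ ℂ ℂ).symm.trans
        (LinearEquiv.funCongrLeft ℂ ℂ (Equiv.ofBijective ε hε).symm))
  have hel : ∀ y x, e y (ε (Sum.inl x)) = y.1 x := fun y x => by
    change Sum.elim y.1 (β y.2) ((Equiv.ofBijective ε hε).symm (Equiv.ofBijective ε hε (Sum.inl x))) = _
    rw [Equiv.symm_apply_apply]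
    rfl
  have her : ∀ y a, e y (ε (Sum.inr a)) = β y.2 a := fun y x => by
    change Sum.elim y.1 (β y.2) ((Equiv.ofBijective ε hε).symm (Equiv.ofBijective ε hε (Sum.inr x))) = _
    rw [Equiv.symm_apply_apply]
    rfl
  refine ⟨⟨n, t, htinj, LinearMap.toMatrix' (e.conj (S.extB ρ₁ ρ₂))⟩, e, ht, ht', hn, hn', ?_, ?_, ?_⟩
  · intro j y
    ext z
    obtain ⟨i, rfl⟩ := hε.2 z
    rw [proj_apply]
    rcases i with x | a
    · erw [hel, hel]
      refine Eq.trans ?_ (S.proj_apply j y.1 x).symm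
      simp [ε]
    · erw [her, her]
      refine (if_neg (Fin.castSucc_ne_last j).symm).trans ?_
      simp
  · intro y
    ext z
    obtain ⟨i, rfl⟩ := hε.2 z
    rw [proj_apply]
    rcases i with x | a
    · erw [hel, hel]
      exact if_neg (Fin.castSucc_ne_last x.1)
    · erw [her, her]
      exact if_pos rfl
  · intro y
    rw [System.endA, Matrix.toLin'_toMatrix', LinearEquiv.conj_apply_apply,
      LinearEquiv.symm_apply_apply]

end System
end Okubo

namespace Okubo

open Module

/-! ### Middle convolutions through models of the quotient -/

section Similar

variable {V W X : Type*} [AddCommGroup V] [Module ℂ V] [AddCommGroup W] [Module ℂ W]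
  [AddCommGroup X] [Module ℂ X] {p : ℕ}

theorem Similar.appendZero {B : Fin p → End ℂ V} {C : Fin p → End ℂ W} (h : Similar B C) :
    Similar (appendZero B) (appendZero C) := by
  obtain ⟨e, he⟩ := h
  refine ⟨e, Fin.lastCases ?_ fun j => ?_⟩
  · simp [Okubo.appendZero]
  · simp [Okubo.appendZero, he]

theorem Similar.swapInfinity {B : Fin p → End ℂ V} {C : Fin p → End ℂ W} (h : Similar B C)
    (j : Fin p) : Similar (swapInfinity j B) (swapInfinity j C) := by
  obtain ⟨e, he⟩ := h
  refine ⟨e, fun i => ?_⟩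
  by_cases hi : i = j
  · subst hi
    simp [Okubo.swapInfinity, he]
  · simp [Okubo.swapInfinity, hi, he]

theorem Similar.addition {B : Fin p → End ℂ V} {C : Fin p → End ℂ W} (h : Similar B C)
    (μ : Fin p → ℂ) : Similar (addition μ B) (addition μ C) := by
  obtain ⟨e, he⟩ := h
  refine ⟨e, fun i => ?_⟩
  rw [Okubo.addition, Okubo.addition, map_add, map_smul, he, End.one_eq_id, End.one_eq_id,
    LinearEquiv.conj_id]

theorem similar_middleConvolution_of_ker_eq {B : Fin p → End ℂ V} {D : Fin p → End ℂ X} {lam : ℂ}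
    (φ : (Fin p → V) →ₗ[ℂ] X) (hφ : Function.Surjective φ)
    (hker : LinearMap.ker φ = convK B ⊔ convL lam B)
    (h : ∀ j u, φ (convolution lam B j u) = D j (φ u)) :
    Similar (middleConvolution lam B) D := by
  refine ⟨(Submodule.quotEquivOfEq _ _ hker.symm).trans (φ.quotKerEquivOfSurjective hφ), fun j => ?_⟩
  ext x
  obtain ⟨u, rfl⟩ := hφ x
  rw [← h, LinearEquiv.conj_apply_apply]
  have a : ((Submodule.quotEquivOfEq _ _ hker.symm).trans (φ.quotKerEquivOfSurjective hφ)).symm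
      (φ u) = Submodule.Quotient.mk u := by
    rw [LinearEquiv.symm_apply_eq]
    rfl
  rw [a]
  rfl

theorem mem_convK {B : Fin p → End ℂ V} {u : Fin p → V} : u ∈ convK B ↔ ∀ j, B j (u j) = 0 := by
  simp [convK, Submodule.mem_pi]

theorem mem_convL {B : Fin p → End ℂ V} {lam : ℂ} {u : Fin p → V} :
    u ∈ convL lam B ↔ ∀ j, ∑ i, B i (u i) + lam • u j = 0 := by
  have h : ∀ j, (∑ i, convolution lam B i) u j = ∑ i, B i (u i) + lam • u j := by
    intro j
    rw [LinearMap.sum_apply, Finset.sum_apply]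
    simp only [convolution_apply]
    rw [Finset.sum_eq_single j (fun i _ hij => Pi.single_eq_of_ne hij.symm _)
      (fun h => absurd (Finset.mem_univ j) h), Pi.single_eq_same]
  rw [convL, LinearMap.mem_ker, funext_iff]
  simp only [h, Pi.zero_apply]

/-- A model of the middle convolution in the case `𝓛 ≤ 𝒦`, which holds as soon as the sum of the
resulting tuple is injective. -/
theorem Similar.middleConvolution {B : Fin p → End ℂ V} {C : Fin p → End ℂ W}
    {D : Fin p → End ℂ X} (hBC : Similar B C) {lam : ℂ} (φ : (Fin p → W) →ₗ[ℂ] X)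
    (hφ : Function.Surjective φ) (hker : ∀ u, φ u = 0 ↔ ∀ j, C j (u j) = 0)
    (h : ∀ j u, φ (Pi.single j (∑ i, C i (u i) + lam • u j)) = D j (φ u))
    (hD : Function.Injective (∑ j, D j : End ℂ X)) :
    Similar (middleConvolution lam B) D := by
  obtain ⟨e, he⟩ := hBC
  have he' : ∀ j v, C j (e v) = e (B j v) := fun j v => by
    rw [he, LinearEquiv.conj_apply_apply, LinearEquiv.symm_apply_apply]
  let ψ : (Fin p → V) →ₗ[ℂ] (Fin p → W) := (LinearEquiv.piCongrRight fun _ => e).toLinearMap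
  have hψ : ∀ u j, ψ u j = e (u j) := fun u j => rfl
  have hφψ : ∀ j u, φ (ψ (convolution lam B j u)) = D j (φ (ψ u)) := by
    intro j u
    rw [← h]
    congr 1
    ext i
    rw [hψ, convolution_apply]
    simp only [hψ, he']
    rcases eq_or_ne i j with rfl | hij
    · simp
    · simp [Pi.single_eq_of_ne hij]
  refine similar_middleConvolution_of_ker_eq (φ ∘ₗ ψ)
    (hφ.comp (LinearEquiv.piCongrRight fun _ => e).surjective) ?_ hφψ
  have hK : LinearMap.ker (φ ∘ₗ ψ) = convK B := by
    ext u
    rw [LinearMap.mem_ker, mem_convK, LinearMap.comp_apply, hker]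
    simp [hψ, he']
  -- It remains to see `𝓛 ≤ 𝒦`: if `∑ G_j` kills `u`, then `∑ D_j` kills the image of `u` in the
  -- model, which must vanish by injectivity.
  rw [hK, left_eq_sup, ← hK]
  intro u hu
  have a : (∑ j, convolution lam B j) u = 0 := hu
  refine hD ?_
  rw [map_zero, LinearMap.sum_apply]
  have b := congrArg (fun u => φ (ψ u)) a
  simp only [LinearMap.sum_apply, map_sum, hφψ, map_zero] at b
  exact b

end Similar

/-! ### Katz's operations applied to the residues -/

namespace System

variable {p : ℕ} (S : System p) {ρ₁ ρ₂ : ℂ}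

/-- The endomorphism `(A - ρ) P_j` of `Im (A - ρ)`. -/
noncomputable def compressed (ρ : ℂ) (j : Fin p) : End ℂ (S.endA - ρ • 1).range :=
  (S.endA - ρ • 1).rangeRestrict ∘ₗ S.proj j ∘ₗ (S.endA - ρ • 1).range.subtype

theorem compressed_apply (ρ : ℂ) (j : Fin p) (w : (S.endA - ρ • 1).range) :
    (S.compressed ρ j w : S.Space) = (S.endA - ρ • 1) (S.proj j w) := rfl

/-- The first middle convolution of the residues of a system. -/
theorem similar_middleConvolution_residue (hA : Function.Injective S.endA) {ρ : ℂ} (hρ : ρ ≠ 0) :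
    Similar (middleConvolution (-ρ) S.residue) (S.compressed ρ) := by
  have hA' : Function.Surjective S.endA := LinearMap.injective_iff_surjective.1 hA
  let φ : (Fin p → S.Space) →ₗ[ℂ] (S.endA - ρ • 1).range :=
    (S.endA - ρ • 1).rangeRestrict ∘ₗ ∑ j, S.residue j ∘ₗ LinearMap.proj j
  have hφ : ∀ u, (φ u : S.Space) = (S.endA - ρ • 1) (∑ j, S.residue j (u j)) := fun u => by
    change (S.endA - ρ • 1) ((∑ j, S.residue j ∘ₗ LinearMap.proj j) u) = _
    rw [LinearMap.sum_apply]; rfl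
  have hPx : ∀ (j : Fin p) (u : Fin p → S.Space),
      S.proj j (∑ i, S.residue i (u i)) = S.residue j (u j) := fun j u => by
    simp only [residue_apply]
    exact S.proj_sum_proj j fun i => S.endA (u i)
  refine similar_middleConvolution_of_ker_eq φ ?_ ?_ ?_
  · rintro ⟨_, x, rfl⟩
    obtain ⟨y, rfl⟩ := hA' x
    refine ⟨fun _ => y, Subtype.ext ?_⟩
    rw [hφ, ← LinearMap.sum_apply, sum_residue]
  · ext u
    rw [LinearMap.mem_ker]
    constructor
    · intro hu
      have hu' : (S.endA - ρ • 1) (∑ j, S.residue j (u j)) = 0 :=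
        (hφ u).symm.trans (congrArg Subtype.val hu)
      set x := ∑ j, S.residue j (u j) with hx
      have hAx : S.endA x = ρ • x := sub_eq_zero.1 hu'
      -- Here `x` is zero or an eigenvector of `A` for `ρ`. The constant tuple `ρ⁻¹ x` is the
      -- component in `𝓛`, and since `A_j (ρ⁻¹ x) = P_j x = A_j u_j`, the remainder lies in `𝒦`.
      have hl : (fun _ : Fin p => ρ⁻¹ • x) ∈ convL (-ρ) S.residue := by
        rw [mem_convL]
        intro j
        rw [← LinearMap.sum_apply, sum_residue, map_smul, hAx, smul_smul, smul_smul,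
          inv_mul_cancel₀ hρ, neg_mul, mul_inv_cancel₀ hρ]
        simp
      have hk : (u - fun _ : Fin p => ρ⁻¹ • x) ∈ convK S.residue := by
        rw [mem_convK]
        intro j
        rw [Pi.sub_apply, map_sub, ← hPx, ← hx, map_smul, residue_apply, hAx, map_smul, smul_smul,
          inv_mul_cancel₀ hρ, one_smul, sub_self]
      have := Submodule.add_mem_sup hk hl
      rwa [sub_add_cancel] at this
    · intro hu
      refine (sup_le ?_ ?_ : convK S.residue ⊔ convL (-ρ) S.residue ≤ LinearMap.ker φ) hu
      · intro u hu
        rw [mem_convK] at hu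
        refine Subtype.ext ?_
        rw [hφ, Finset.sum_eq_zero fun j _ => hu j, map_zero]
        rfl
      · intro u hu
        rw [mem_convL] at hu
        refine Subtype.ext ?_
        rw [hφ]
        set x := ∑ j, S.residue j (u j) with hx
        have hx' : S.endA x = ρ • x := by
          -- Membership in `𝓛` makes every `ρ u_j` equal to `x`, whence `ρ x = ∑ A_j (ρ u_j) = A x`.
          have a : ∀ j, x = ρ • u j := fun j => by
            have := hu j
            rw [neg_smul, ← sub_eq_add_neg, sub_eq_zero] at this
            exact this
          have b : ρ • x = ∑ j, S.residue j (ρ • u j) := by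
            rw [hx, Finset.smul_sum]
            simp only [map_smul]
          simp only [← a] at b
          rw [b, ← LinearMap.sum_apply, sum_residue]
        exact sub_eq_zero.2 hx'
  · intro j u
    refine Subtype.ext ?_
    rw [compressed_apply, hφ, hφ, convolution_apply]
    congr 1
    rw [Finset.sum_eq_single j (fun i _ hij => by rw [Pi.single_eq_of_ne hij, map_zero]) (by simp),
      Pi.single_eq_same, map_add, map_smul, ← hPx, residue_apply, LinearMap.sub_apply, map_sub,
      LinearMap.smul_apply, map_smul, neg_smul, ← sub_eq_add_neg]
    rfl

theorem smul_sub_mem_range_quad (w : (S.endA - ρ₁ • 1).range) :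
    (ρ₂ • 1 - S.endA) (w : S.Space) ∈ (S.quad ρ₁ ρ₂).range := by
  obtain ⟨_, x, rfl⟩ := w
  refine ⟨-x, ?_⟩
  rw [quad_apply']
  simp only [LinearMap.sub_apply, map_neg]
  module

/-- The map `(u_1, …, u_{p+1}) ↦ (∑ P_j u_j, (ρ₂ - A) u_{p+1})`. -/
noncomputable def convMap (ρ₁ ρ₂ : ℂ) :
    (Fin (p + 1) → (S.endA - ρ₁ • 1).range) →ₗ[ℂ] S.ExtSum ρ₁ ρ₂ :=
  LinearMap.prod
    (∑ j : Fin p, S.proj j ∘ₗ (S.endA - ρ₁ • 1).range.subtype ∘ₗ LinearMap.proj j.castSucc)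
    (LinearMap.codRestrict _ ((ρ₂ • 1 - S.endA) ∘ₗ (S.endA - ρ₁ • 1).range.subtype)
      S.smul_sub_mem_range_quad ∘ₗ LinearMap.proj (Fin.last p))

theorem convMap_fst (u : Fin (p + 1) → (S.endA - ρ₁ • 1).range) :
    (S.convMap ρ₁ ρ₂ u).1 = ∑ j : Fin p, S.proj j (u j.castSucc) := by
  change (∑ j : Fin p, S.proj j ∘ₗ (S.endA - ρ₁ • 1).range.subtype ∘ₗ
    LinearMap.proj j.castSucc) u = _
  rw [LinearMap.sum_apply]; rfl

theorem convMap_snd (u : Fin (p + 1) → (S.endA - ρ₁ • 1).range) :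
    ((S.convMap ρ₁ ρ₂ u).2 : S.Space) = (ρ₂ • 1 - S.endA) (u (Fin.last p) : S.Space) := rfl

theorem addition_compressed_castSucc (j : Fin p) :
    addition (Pi.single (Fin.last p) (ρ₂ - ρ₁)) (swapInfinity (Fin.last p)
      (appendZero (S.compressed ρ₁))) j.castSucc = S.compressed ρ₁ j := by
  simp [addition, swapInfinity, appendZero]

theorem addition_compressed_last (w : (S.endA - ρ₁ • 1).range) :
    (addition (Pi.single (Fin.last p) (ρ₂ - ρ₁)) (swapInfinity (Fin.last p)
      (appendZero (S.compressed ρ₁))) (Fin.last p) w : S.Space) = (ρ₂ • 1 - S.endA) (w : S.Space) := by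
  have h : ((∑ j, S.compressed ρ₁ j) w : S.Space) = (S.endA - ρ₁ • 1) (w : S.Space) := by
    rw [LinearMap.sum_apply, Submodule.coe_sum]
    simp only [compressed_apply]
    rw [← map_sum, sum_proj_apply]
  have h' : addition (Pi.single (Fin.last p) (ρ₂ - ρ₁)) (swapInfinity (Fin.last p)
      (appendZero (S.compressed ρ₁))) (Fin.last p) =
      -(∑ j, S.compressed ρ₁ j) + (ρ₂ - ρ₁) • 1 := by
    simp [addition, swapInfinity, appendZero, Fin.sum_univ_castSucc]
  rw [h', LinearMap.add_apply, Submodule.coe_add, LinearMap.neg_apply, Submodule.coe_neg, h,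
    LinearMap.smul_apply, Submodule.coe_smul]
  simp only [LinearMap.sub_apply, LinearMap.smul_apply, End.one_apply]
  module

variable {S} in
theorem IsExtension.injective_endA {S' : System (p + 1)} {e : S.ExtSum ρ₁ ρ₂ ≃ₗ[ℂ] S'.Space}
    (hE : S.IsExtension ρ₁ ρ₂ S' e) (hρ : ρ₁ * ρ₂ ≠ 0) : Function.Injective S'.endA := by
  rw [injective_iff_map_eq_zero]
  intro v hv
  obtain ⟨y, rfl⟩ := e.surjective v
  rw [hE.endA, LinearEquiv.map_eq_zero_iff] at hv
  have a := S.extB_extB ρ₁ ρ₂ y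
  rw [hv, map_zero, smul_zero, zero_sub, eq_comm, neg_eq_zero, smul_eq_zero] at a
  rw [a.resolve_left hρ, map_zero]

-- The second middle convolution, modelled by `convMap`. Its kernel is `𝒦` because `A - ρ₁` is
-- injective on each `Im P_j`; it is onto because `P_j (A - ρ₁)` maps onto `Im P_j`.
variable {S} in
theorem IsExtension.similar {S' : System (p + 1)} {e : S.ExtSum ρ₁ ρ₂ ≃ₗ[ℂ] S'.Space}
    (hE : S.IsExtension ρ₁ ρ₂ S' e) (hS : S.RankConditions) (hρ : ρ₁ * ρ₂ ≠ 0) :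
    Similar (middleConvolution ρ₁ (addition (Pi.single (Fin.last p) (ρ₂ - ρ₁))
      (swapInfinity (Fin.last p) (appendZero (middleConvolution (-ρ₁) S.residue))))) S'.residue := by
  obtain ⟨hA, hS⟩ := S.rank_conditions_iff.1 hS
  have hτ : S.endA + (-ρ₁) • 1 = S.endA - ρ₁ • 1 := LinearMap.ext fun v => by
    simp [sub_eq_add_neg]
  have hker : ∀ (j : Fin p) (v : S.Space), (S.endA - ρ₁ • 1) (S.proj j v) = 0 → S.proj j v = 0 := by
    intro j v h
    refine (hS (-ρ₁) j).1 v ?_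
    rwa [hτ]
  refine ((((S.similar_middleConvolution_residue hA (left_ne_zero_of_mul hρ)).appendZero).swapInfinity
    _).addition _).middleConvolution (e.toLinearMap ∘ₗ S.convMap ρ₁ ρ₂) ?_ ?_ ?_ ?_
  · refine e.surjective.comp ?_
    rintro ⟨x, _, z, rfl⟩
    have hy : ∀ j : Fin p, ∃ y, S.proj j ((S.endA - ρ₁ • 1) y) = S.proj j x := fun j => by
      obtain ⟨y, hy⟩ := (hS (-ρ₁) j).2 x
      exact ⟨y, by rwa [hτ] at hy⟩
    choose y hy using hy
    -- The components of a preimage may be chosen independently for each `j`. The last one uses `-z`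
    -- because `(ρ₂ - A)(A - ρ₁) = -(A - ρ₁)(A - ρ₂)`.
    refine ⟨Fin.snoc (α := fun _ => (S.endA - ρ₁ • 1).range) (fun j => ⟨(S.endA - ρ₁ • 1) (y j), y j, rfl⟩)
      ⟨(S.endA - ρ₁ • 1) (-z), -z, rfl⟩, ExtSum.ext _ _ _ ?_ ?_⟩
    · rw [convMap_fst]
      simp only [Fin.snoc_castSucc, hy, sum_proj_apply]
    · rw [convMap_snd]
      simp only [Fin.snoc_last]
      rw [quad_apply']
      simp only [LinearMap.sub_apply, map_neg]
      module
  · intro u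
    rw [LinearMap.comp_apply, LinearEquiv.coe_coe, LinearEquiv.map_eq_zero_iff]
    constructor
    · intro hu
      have h1 := congrArg Prod.fst hu
      have h2 := congrArg (fun y : S.ExtSum ρ₁ ρ₂ => (y.2 : S.Space)) hu
      simp only [convMap_fst, convMap_snd] at h1 h2
      refine Fin.lastCases ?_ fun j => ?_
      · exact Subtype.ext ((S.addition_compressed_last _).trans h2)
      · rw [addition_compressed_castSucc]
        refine Subtype.ext ?_
        have h3 := S.proj_sum_proj j fun j => u j.castSucc
        rw [h1] at h3
        rw [compressed_apply, ← h3]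
        simp
    · intro hu
      refine ExtSum.ext _ _ _ ?_ ?_
      · rw [convMap_fst]
        refine Finset.sum_eq_zero fun j _ => hker j _ ?_
        have a := hu j.castSucc
        rw [addition_compressed_castSucc] at a
        exact congrArg Subtype.val a
      · rw [convMap_snd, ← addition_compressed_last, hu]
        rfl
  · intro j u
    -- The common block row depends on `u` only through its image `(x, w)` under `convMap`, as `(A -
    -- ρ₁) x + w`. Adding `ρ₁ u_j` and applying `convMap` then yields the `j`-th block row of `Â`.
    have hsum : ((∑ i, addition (Pi.single (Fin.last p) (ρ₂ - ρ₁)) (swapInfinity (Fin.last p)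
        (appendZero (S.compressed ρ₁))) i (u i) : (S.endA - ρ₁ • 1).range) : S.Space) =
        (S.endA - ρ₁ • 1) (S.convMap ρ₁ ρ₂ u).1 + (S.convMap ρ₁ ρ₂ u).2 := by
      rw [Fin.sum_univ_castSucc, Submodule.coe_add, addition_compressed_last, convMap_snd,
        convMap_fst, Submodule.coe_sum, map_sum]
      simp only [addition_compressed_castSucc, compressed_apply]
    rw [residue_apply, LinearMap.comp_apply, LinearMap.comp_apply, LinearEquiv.coe_coe, hE.endA]
    generalize hg : (∑ i, addition (Pi.single (Fin.last p) (ρ₂ - ρ₁)) (swapInfinity (Fin.last p)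
        (appendZero (S.compressed ρ₁))) i (u i)) + ρ₁ • u j = g
    have hg' : (g : S.Space) =
        (S.endA - ρ₁ • 1) (S.convMap ρ₁ ρ₂ u).1 + (S.convMap ρ₁ ρ₂ u).2 + ρ₁ • (u j : S.Space) := by
      rw [← hg, Submodule.coe_add, hsum]; rfl
    revert hg'
    refine Fin.lastCases (fun hg' => ?_) (fun j hg' => ?_) j
    · rw [hE.proj_last]
      congr 1
      refine ExtSum.ext _ _ _ ?_ ?_
      · rw [convMap_fst]
        exact Finset.sum_eq_zero fun j _ => by
          rw [Pi.single_eq_of_ne (Fin.castSucc_ne_last j)]; simp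
      · rw [convMap_snd, Pi.single_eq_same, extB_snd, hg', map_add, map_add, map_smul, ← convMap_snd,
          quad_apply']
        simp only [LinearMap.sub_apply, LinearMap.smul_apply, End.one_apply, map_sub, map_smul]
        module
    · rw [hE.proj_castSucc]
      congr 1
      refine ExtSum.ext _ _ _ ?_ ?_
      · rw [convMap_fst, Finset.sum_eq_single j
          (fun i _ hij => by
            rw [Pi.single_eq_of_ne fun h => hij (Fin.castSucc_injective _ h)]; simp) (by simp),
          Pi.single_eq_same, hg', extB_fst, map_add, map_add, map_smul,
          ← S.proj_sum_proj j fun j => u j.castSucc, ← convMap_fst (ρ₂ := ρ₂)]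
        simp only [LinearMap.sub_apply, LinearMap.smul_apply, End.one_apply, map_sub, map_smul,
          map_add]
        module
      · rw [convMap_snd, Pi.single_eq_of_ne (Fin.castSucc_ne_last j).symm]
        simp
  · rw [sum_residue]
    exact hE.injective_endA hρ

end System
end Okubo

/-! ### Matrices, rank conditions and irreducibility of the extended system -/

namespace Okubo

open Module

namespace System

variable {p : ℕ} {S : System p} {ρ₁ ρ₂ : ℂ} {S' : System (p + 1)}
  {e : S.ExtSum ρ₁ ρ₂ ≃ₗ[ℂ] S'.Space}

theorem IsExtension.rank_eq (hE : S.IsExtension ρ₁ ρ₂ S' e) :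
    S'.rank = S.rank + finrank ℂ (S.quad ρ₁ ρ₂).range := by
  rw [rank, Fin.sum_univ_castSucc, hE.n_last]
  simp only [hE.n_castSucc]
  rfl

theorem rank_eq_finrank (e : S.ExtSum ρ₁ ρ₂ ≃ₗ[ℂ] S'.Space) :
    S'.rank = finrank ℂ (S.extSpace ρ₁ ρ₂) := by
  rw [← finrank_space, ← e.finrank_eq, (S.extEquiv ρ₁ ρ₂).finrank_eq]

theorem IsExtension.toLin'_A (hE : S.IsExtension ρ₁ ρ₂ S' e) :
    Matrix.toLin' S'.A = ((S.extEquiv ρ₁ ρ₂).trans e).conj (S.extA ρ₁ ρ₂) := by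
  refine LinearMap.ext fun v => ?_
  obtain ⟨y, rfl⟩ := e.surjective v
  refine (hE.endA y).trans ?_
  rw [LinearEquiv.conj_apply_apply, LinearEquiv.symm_trans_apply, LinearEquiv.symm_apply_apply]
  rfl

theorem IsExtension.toLin'_T (hE : S.IsExtension ρ₁ ρ₂ S' e) {s : ℂ}
    (ht : ∀ j : Fin p, S'.t j.castSucc = S.t j) (hs : S'.t (Fin.last p) = s) :
    Matrix.toLin' S'.T = ((S.extEquiv ρ₁ ρ₂).trans e).conj (S.extT ρ₁ ρ₂ s) := by
  refine LinearMap.ext fun v => ?_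
  obtain ⟨y, rfl⟩ := e.surjective v
  rw [LinearEquiv.conj_apply_apply, LinearEquiv.symm_trans_apply, LinearEquiv.symm_apply_apply,
    toLin'_T_apply, Fin.sum_univ_castSucc, hs, hE.proj_last]
  simp only [ht, hE.proj_castSucc]
  simp only [← map_smul]
  rw [← map_sum, ← map_add, LinearEquiv.trans_apply]
  congr 1
  refine ExtSum.ext _ _ _ ?_ ?_
  · rw [Prod.fst_add, Prod.fst_sum]
    simp only [Prod.smul_fst, smul_zero, add_zero]
    exact (S.toLin'_T_apply y.1).symm
  · rw [Prod.snd_add, Prod.snd_sum]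
    simp only [Prod.smul_snd, smul_zero, Finset.sum_const_zero, zero_add]
    rfl

/-- For the new block, the off-diagonal blocks of `Â` suffice whatever `τ` is: the upper right one
is an inclusion, and the lower left one maps onto the new summand. The old blocks inherit the
conditions from `A`. -/
theorem IsExtension.rankConditions (hE : S.IsExtension ρ₁ ρ₂ S' e) (hS : S.RankConditions)
    (hρ : ρ₁ * ρ₂ ≠ 0) : S'.RankConditions := by
  obtain ⟨hA, hS⟩ := S.rank_conditions_iff.1 hS
  have happ : ∀ (τ : ℂ) y, (S'.endA + τ • 1) (e y) = e (S.extB ρ₁ ρ₂ y + τ • y) := fun τ y => by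
    rw [LinearMap.add_apply, hE.endA, map_add, map_smul]; rfl
  refine S'.rank_conditions_iff.2 ⟨hE.injective_endA hρ, fun τ j => ?_⟩
  refine Fin.lastCases ⟨fun v hv => ?_, fun v => ?_⟩ (fun j => ⟨fun v hv => ?_, fun v => ?_⟩) j
  all_goals obtain ⟨y, rfl⟩ := e.surjective v
  · rw [hE.proj_last] at hv ⊢
    rw [happ, LinearEquiv.map_eq_zero_iff] at hv
    have h1 := congrArg Prod.fst hv
    rw [Prod.fst_add, extB_fst] at h1
    have h2 : (y.2 : S.Space) = 0 := by simpa using h1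
    rw [LinearEquiv.map_eq_zero_iff]
    exact ExtSum.ext _ _ _ rfl h2
  · obtain ⟨x, _, z, rfl⟩ := y
    refine ⟨e (-z, 0), ?_⟩
    rw [happ, hE.proj_last, hE.proj_last]
    congr 1
    refine ExtSum.ext _ _ _ rfl ?_
    simp only [Prod.snd_add, Submodule.coe_add, extB_snd]
    simp
  · rw [hE.proj_castSucc] at hv ⊢
    rw [happ, LinearEquiv.map_eq_zero_iff] at hv
    have h1 := congrArg Prod.fst hv
    rw [Prod.fst_add, extB_fst] at h1
    rw [LinearEquiv.map_eq_zero_iff]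
    refine ExtSum.ext _ _ _ ((hS τ j).1 y.1 ?_) rfl
    simpa using h1
  · obtain ⟨u, hu⟩ := (hS τ j).2 y.1
    refine ⟨e (u, 0), ?_⟩
    rw [happ, hE.proj_castSucc, hE.proj_castSucc]
    congr 1
    refine ExtSum.ext _ _ _ ?_ rfl
    rw [← hu]
    simp [extB_fst]

/-- With `Q = (A - ρ₁)(A - ρ₂)`, an invariant `U` for the old system extends to the invariant `U ⊕ Q
U`, and an invariant `Y` for the new system restricts to `Y ∩ ℂⁿ`. The off-diagonal blocks of `Â`
show that `Y` is trivial if this intersection is. -/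
theorem IsExtension.isLinearlyIrreducible_iff (hE : S.IsExtension ρ₁ ρ₂ S' e)
    (hS : S.RankConditions) (hρ : ρ₁ * ρ₂ ≠ 0) :
    IsLinearlyIrreducible S'.residue ↔ IsLinearlyIrreducible S.residue := by
  obtain ⟨hA, -⟩ := S.rank_conditions_iff.1 hS
  rw [S.isLinearlyIrreducible_iff hA, S'.isLinearlyIrreducible_iff (hE.injective_endA hρ)]
  constructor
  · intro h U hU hUP
    have hUQ : ∀ u ∈ U, S.quad ρ₁ ρ₂ u ∈ U := fun u hu => by
      rw [quad_eq]
      exact U.add_mem (U.sub_mem (hU _ (hU _ hu)) (U.smul_mem _ (hU _ hu))) (U.smul_mem _ hu)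
    let Y : Submodule ℂ (S.ExtSum ρ₁ ρ₂) :=
      Submodule.prod U ((U.map (S.quad ρ₁ ρ₂)).comap (S.quad ρ₁ ρ₂).range.subtype)
    have hY : Y.map e.toLinearMap = ⊥ ∨ Y.map e.toLinearMap = ⊤ := by
      refine h _ ?_ ?_
      · rintro _ ⟨⟨u, w⟩, ⟨hu, x, hx, hw⟩, rfl⟩
        have hw : S.quad ρ₁ ρ₂ x = w := hw
        refine ⟨_, ⟨?_, ?_⟩, (hE.endA _).symm⟩
        · rw [extB_fst]
          refine U.add_mem (hU _ hu) ?_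
          change (w : S.Space) ∈ U
          rw [← hw]
          exact hUQ x hx
        · refine ⟨-u + (-S.endA x + (ρ₁ + ρ₂) • x), U.add_mem (U.neg_mem hu)
            (U.add_mem (U.neg_mem (hU _ hx)) (U.smul_mem _ hx)), ?_⟩
          rw [Submodule.subtype_apply, extB_snd]
          change _ = -S.quad ρ₁ ρ₂ u + (-S.endA w + (ρ₁ + ρ₂) • (w : S.Space))
          rw [← hw]
          simp only [quad_eq, map_add, map_sub, map_smul, map_neg]
      · refine Fin.lastCases ?_ fun j => ?_
        · rintro _ ⟨⟨u, w⟩, ⟨hu, hw⟩, rfl⟩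
          exact ⟨(0, w), ⟨U.zero_mem, hw⟩, (hE.proj_last (u, w)).symm⟩
        · rintro _ ⟨⟨u, w⟩, ⟨hu, hw⟩, rfl⟩
          exact ⟨(S.proj j u, 0), ⟨hUP j u hu, Submodule.zero_mem _⟩, (hE.proj_castSucc j (u, w)).symm⟩
    refine hY.imp (fun hY => ?_) fun hY => ?_
    · rw [Submodule.eq_bot_iff]
      intro u hu
      have a : e (u, 0) ∈ Y.map e.toLinearMap := ⟨(u, 0), ⟨hu, Submodule.zero_mem _⟩, rfl⟩
      rw [hY, Submodule.mem_bot, LinearEquiv.map_eq_zero_iff] at a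
      exact congrArg Prod.fst a
    · rw [Submodule.eq_top_iff']
      intro u
      have : e (u, 0) ∈ Y.map e.toLinearMap := hY ▸ Submodule.mem_top
      obtain ⟨y, hy, hy'⟩ := this
      have := e.injective hy'
      rw [this] at hy
      exact hy.1
  · intro h Y hY hYP
    have hmem : ∀ y, e y ∈ Y → e (y.1, 0) ∈ Y := fun y hy => by
      have a : e (y.1, 0) = ∑ j : Fin p, S'.proj j.castSucc (e y) := by
        simp only [hE.proj_castSucc]
        rw [← map_sum]
        congr 1
        refine ExtSum.ext _ _ _ ?_ ?_
        · rw [Prod.fst_sum]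
          exact (S.sum_proj_apply _).symm
        · simp [Prod.snd_sum]
      rw [a]
      exact Y.sum_mem fun j _ => hYP _ _ hy
    have hlast : ∀ y, e y ∈ Y → e (0, y.2) ∈ Y := fun y hy => by
      rw [← hE.proj_last]
      exact hYP _ _ hy
    let U : Submodule ℂ S.Space := Y.comap (e.toLinearMap ∘ₗ LinearMap.inl ℂ _ _)
    have hU : ∀ u, u ∈ U ↔ e (u, 0) ∈ Y := fun u => Iff.rfl
    have hUU : U = ⊥ ∨ U = ⊤ := by
      refine h U ?_ ?_
      · intro u hu
        have a := hY _ hu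
        rw [LinearMap.comp_apply, LinearEquiv.coe_coe, hE.endA] at a
        have b := hmem _ a
        rw [extB_fst] at b
        rw [hU]
        simpa using b
      · intro j u hu
        have a := hYP j.castSucc _ hu
        rw [LinearMap.comp_apply, LinearEquiv.coe_coe, hE.proj_castSucc] at a
        exact a
    rcases hUU with hUb | hUt
    · refine Or.inl ?_
      rw [Submodule.eq_bot_iff]
      intro v hv
      obtain ⟨y, rfl⟩ := e.surjective v
      have h1 : y.1 = 0 := by
        have := (hU _).2 (hmem y hv)
        rwa [hUb] at this
      -- The upper component of `Â (0, w)` is `w`, so `w` lies in `U`.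
      have h2 : (y.2 : S.Space) = 0 := by
        have a := hY _ (hlast y hv)
        rw [hE.endA] at a
        have b := (hU _).2 (hmem _ a)
        rw [hUb, Submodule.mem_bot, extB_fst] at b
        simpa using b
      rw [LinearEquiv.map_eq_zero_iff]
      exact ExtSum.ext _ _ _ h1 h2
    · refine Or.inr ?_
      rw [Submodule.eq_top_iff']
      intro v
      obtain ⟨⟨u, _, z, rfl⟩, rfl⟩ := e.surjective v
      have h1 : e (u, 0) ∈ Y := (hU u).1 (hUt ▸ Submodule.mem_top)
      -- The lower component of `Â (-z, 0)` is `(A - ρ₁)(A - ρ₂) z`, so `Y` contains the whole new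
      -- summand.
      have h2 : e (-z, 0) ∈ Y := (hU _).1 (hUt ▸ Submodule.mem_top)
      have h3 := hY _ h2
      rw [hE.endA] at h3
      have h4 := Y.add_mem h1 (hlast _ h3)
      rw [← map_add] at h4
      convert h4 using 2
      refine ExtSum.ext _ _ _ ?_ ?_
      · simp
      · rw [Prod.snd_add, Submodule.coe_add, extB_snd]
        simp

end System
end Okubo

/-! ### The Riemann scheme of the extended system -/

namespace Okubo

open Module

namespace System

variable {p : ℕ} {S : System p} {ρ₁ ρ₂ : ℂ} {S' : System (p + 1)}
  {e : S.ExtSum ρ₁ ρ₂ ≃ₗ[ℂ] S'.Space}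

/-- `A` on `Im (A - ρ₁)(A - ρ₂)`. -/
noncomputable def endAQuad (S : System p) (ρ₁ ρ₂ : ℂ) : End ℂ (S.quad ρ₁ ρ₂).range :=
  S.endA.restrict (S.endA_mem_range_quad ρ₁ ρ₂)

theorem endAQuad_apply (w : (S.quad ρ₁ ρ₂).range) :
    (S.endAQuad ρ₁ ρ₂ w : S.Space) = S.endA w := rfl

/-- Splitting off the two largest multiplicities of `ρ₁` and `ρ₂`. -/
theorem hasKerDims_endAQuad {m₁ m₂ : ℕ} {rest : Column} (h12 : ρ₂ = ρ₁ → m₂ ≤ m₁)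
    (h1 : ∀ x ∈ rest, x.1 = ρ₁ → x.2 ≤ m₁) (h2 : ∀ x ∈ rest, x.1 = ρ₂ → x.2 ≤ m₂)
    (h : HasKerDims S.endA ((ρ₁, m₁) :: (ρ₂, m₂) :: rest)) :
    finrank ℂ (LinearMap.ker (S.endA - ρ₁ • 1)) = m₁ ∧
    finrank ℂ (S.quad ρ₁ ρ₂).range + m₁ + m₂ = S.rank ∧
    HasKerDims (S.endAQuad ρ₁ ρ₂) rest := by
  set g : End ℂ (S.endA - ρ₁ • 1).range := S.endA.restrict (range_sub_smul_invariant S.endA ρ₁) with hg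
  obtain ⟨hm1, h⟩ := (HasKerDims.cons_iff (g := g) (fun x hx hx' => by
    rcases List.mem_cons.1 hx with rfl | hx
    · exact h12 hx'
    · exact h1 x hx hx') (S.endA - ρ₁ • 1).range.subtype (Submodule.subtype_injective _)
    (Submodule.range_subtype _) (fun w => rfl)).1 h
  have hle : (S.quad ρ₁ ρ₂).range ≤ (S.endA - ρ₁ • 1).range := LinearMap.range_comp_le_range _ _
  have hr : (Submodule.inclusion hle).range = (g - ρ₂ • 1).range := by
    ext w
    constructor
    · rintro ⟨⟨_, x, rfl⟩, rfl⟩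
      exact ⟨⟨(S.endA - ρ₁ • 1) x, x, rfl⟩, Subtype.ext (S.quad_apply' ρ₁ ρ₂ x).symm⟩
    · rintro ⟨⟨_, x, rfl⟩, rfl⟩
      exact ⟨⟨S.quad ρ₁ ρ₂ x, x, rfl⟩, Subtype.ext (S.quad_apply' ρ₁ ρ₂ x)⟩
  obtain ⟨hm2, h⟩ := (HasKerDims.cons_iff (g := S.endAQuad ρ₁ ρ₂) h2 (Submodule.inclusion hle)
    (Submodule.inclusion_injective hle) hr (fun w => rfl)).1 h
  refine ⟨hm1, ?_, h⟩
  have a := (S.endA - ρ₁ • 1).finrank_range_add_finrank_ker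
  have b := (g - ρ₂ • 1).finrank_range_add_finrank_ker
  rw [← hr, LinearMap.finrank_range_of_inj (Submodule.inclusion_injective hle)] at b
  rw [finrank_space] at a
  omega

/-- The eigenspace of `Â` for `ρ₁` is the graph of `-(A - ρ₁)` over the preimage of `Im (A - ρ₁)(A -
ρ₂)` under `A - ρ₁`; its dimension is `m₁` plus that of this image, that is `n - m₂`. By the
quadratic relation `Â` is the scalar `ρ₂` on `Im (Â - ρ₁)`, which settles the rest, also when `ρ₁ =
ρ₂`. -/
theorem IsExtension.hasKerDims_endA (hE : S.IsExtension ρ₁ ρ₂ S' e) {m₁ m₂ : ℕ}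
    (h12 : ρ₂ = ρ₁ → m₂ ≤ m₁) (hm1 : finrank ℂ (LinearMap.ker (S.endA - ρ₁ • 1)) = m₁)
    (hm : finrank ℂ (S.quad ρ₁ ρ₂).range + m₁ + m₂ = S.rank) :
    HasKerDims S'.endA [(ρ₁, S.rank - m₂), (ρ₂, S.rank - m₁)] := by
  have hker : finrank ℂ (LinearMap.ker (S'.endA - ρ₁ • 1)) = S.rank - m₂ := by
    set N := (S.quad ρ₁ ρ₂).range.comap (S.endA - ρ₁ • 1) with hN
    have hle : (S.quad ρ₁ ρ₂).range ≤ (S.endA - ρ₁ • 1).range := LinearMap.range_comp_le_range _ _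
    have h1 : finrank ℂ N = m₁ + finrank ℂ (S.quad ρ₁ ρ₂).range := by
      rw [hN, finrank_comap_eq, hm1, inf_eq_left.2 hle]
    have hNm : ∀ u : N, (S.endA - ρ₁ • 1) (u : S.Space) ∈ (S.quad ρ₁ ρ₂).range := fun u =>
      Submodule.mem_comap.1 (hN ▸ u.2)
    let j : N →ₗ[ℂ] S'.Space := e.toLinearMap ∘ₗ LinearMap.prod N.subtype
      (-LinearMap.codRestrict (S.quad ρ₁ ρ₂).range ((S.endA - ρ₁ • 1) ∘ₗ N.subtype)
        hNm)
    have hj : ∀ u : N, j u = e (u, -⟨(S.endA - ρ₁ • 1) u, hNm u⟩) := fun u => rfl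
    have hji : Function.Injective j := fun u v huv => by
      rw [hj, hj] at huv
      exact Subtype.ext (congrArg Prod.fst (e.injective huv))
    have happ : ∀ y, (S'.endA - ρ₁ • 1) (e y) = 0 ↔ S.extB ρ₁ ρ₂ y = ρ₁ • y := fun y => by
      rw [LinearMap.sub_apply, sub_eq_zero, hE.endA, LinearMap.smul_apply, End.one_apply, ← map_smul,
        e.injective.eq_iff]
    have hjr : j.range = LinearMap.ker (S'.endA - ρ₁ • 1) := by
      ext v
      obtain ⟨y, rfl⟩ := e.surjective v
      rw [LinearMap.mem_ker, happ]
      constructor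
      · rintro ⟨u, hu⟩
        rw [hj] at hu
        rw [← e.injective hu]
        refine ExtSum.ext _ _ _ ?_ ?_
        · rw [extB_fst, Prod.smul_fst, Submodule.coe_neg]
          simp only [LinearMap.sub_apply, LinearMap.smul_apply, End.one_apply]
          module
        · rw [extB_snd, Prod.smul_snd, Submodule.coe_smul, Submodule.coe_neg, quad_apply']
          simp only [LinearMap.sub_apply, LinearMap.smul_apply, End.one_apply, map_neg, map_sub,
            map_smul]
          module
      · intro h
        have h1 := congrArg Prod.fst h
        rw [extB_fst, Prod.smul_fst] at h1
        have h2 : (S.endA - ρ₁ • 1) y.1 = -(y.2 : S.Space) := by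
          rw [LinearMap.sub_apply, LinearMap.smul_apply, End.one_apply, ← h1]
          abel
        refine ⟨⟨y.1, ?_⟩, ?_⟩
        · rw [hN, Submodule.mem_comap, h2]
          exact Submodule.neg_mem _ y.2.2
        · rw [hj]
          congr 1
          refine ExtSum.ext _ _ _ rfl ?_
          rw [Submodule.coe_neg]
          exact (congrArg Neg.neg h2).trans (neg_neg _)
    rw [← hjr, LinearMap.finrank_range_of_inj hji, h1]
    omega
  have hdim := (S'.endA - ρ₁ • 1).finrank_range_add_finrank_ker
  rw [finrank_space, hE.rank_eq, hker] at hdim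
  have hdim' : S.rank - m₁ = finrank ℂ (S'.endA - ρ₁ • 1).range := by omega
  rw [hdim']
  refine (HasKerDims.cons_iff (g := S'.endA.restrict (range_sub_smul_invariant S'.endA ρ₁)) ?_
    (S'.endA - ρ₁ • 1).range.subtype (Submodule.subtype_injective _) (Submodule.range_subtype _)
    (fun w => rfl)).2 ⟨hker, hasKerDims_singleton ?_⟩
  · intro x hx h
    rw [List.mem_singleton] at hx
    subst hx
    have := h12 h
    simp only
    omega
  · rintro ⟨_, v, rfl⟩
    refine Subtype.ext ?_
    obtain ⟨y, rfl⟩ := e.surjective v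
    have a : (S'.endA - ρ₁ • 1) (e y) = e (S.extB ρ₁ ρ₂ y - ρ₁ • y) := by
      rw [LinearMap.sub_apply, hE.endA, map_sub, map_smul]; rfl
    change S'.endA ((S'.endA - ρ₁ • 1) (e y)) = ρ₂ • ((S'.endA - ρ₁ • 1) (e y))
    have b : S.extB ρ₁ ρ₂ (S.extB ρ₁ ρ₂ y - ρ₁ • y) = ρ₂ • (S.extB ρ₁ ρ₂ y - ρ₁ • y) := by
      rw [map_sub, map_smul, extB_extB]
      module
    rw [a, hE.endA, b, map_smul]

/-- `A` is surjective, so `P_j A` has the image of `P_j`. The term `0 • 1` matches the shape of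
`HasKerDims.cons_iff` at the eigenvalue `0`. -/
theorem range_residue (T : System p) (hT : T.RankConditions) (j : Fin p) :
    (T.residue j - (0 : ℂ) • 1).range = (T.proj j).range := by
  obtain ⟨hA, -⟩ := T.rank_conditions_iff.1 hT
  rw [zero_smul, sub_zero]
  ext v
  constructor
  · rintro ⟨u, rfl⟩
    exact ⟨T.endA u, (T.residue_apply j u).symm⟩
  · rintro ⟨u, rfl⟩
    obtain ⟨w, rfl⟩ := LinearMap.injective_iff_surjective.1 hA u
    exact ⟨w, T.residue_apply j w⟩

theorem finrank_ker_residue (T : System p) (hT : T.RankConditions) (j : Fin p) :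
    finrank ℂ (LinearMap.ker (T.residue j - (0 : ℂ) • 1)) = T.rank - T.n j := by
  have a := (T.residue j - (0 : ℂ) • 1).finrank_range_add_finrank_ker
  rw [range_residue T hT, finrank_range_proj, finrank_space] at a
  omega

/-- On the common image `Im P_j` the old and new residues act by the same diagonal block of `A`.
Only the kernel grows, so only the multiplicity of the leading `0` changes. -/
theorem IsExtension.hasKerDims_residue_castSucc (hE : S.IsExtension ρ₁ ρ₂ S' e)
    (hS : S.RankConditions) (hS' : S'.RankConditions) {j : Fin p} {c : Column}
    (h : HasKerDims (S.residue j) ((0, S.rank - S.n j) :: c)) :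
    HasKerDims (S'.residue j.castSucc) ((0, S'.rank - S.n j) :: c) := by
  have hmax : ∀ x ∈ c, x.1 = 0 → x.2 ≤ S.rank - S.n j := fun x hx hx' => by
    have a := h.le_finrank_ker (List.mem_cons_of_mem _ hx)
    rwa [hx', finrank_ker_residue S hS] at a
  have hinv : ∀ v ∈ (S.proj j).range, S.residue j v ∈ (S.proj j).range := fun v _ =>
    ⟨S.endA v, (S.residue_apply j v).symm⟩
  obtain ⟨-, hc⟩ := (HasKerDims.cons_iff (g := (S.residue j).restrict hinv) hmax
    (S.proj j).range.subtype (Submodule.subtype_injective _)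
    ((Submodule.range_subtype _).trans (range_residue S hS j).symm) (fun w => rfl)).1 h
  have hrank := hE.rank_eq
  refine (HasKerDims.cons_iff (g := (S.residue j).restrict hinv)
    (fun x hx hx' => (hmax x hx hx').trans (by omega))
    (e.toLinearMap ∘ₗ LinearMap.inl ℂ _ _ ∘ₗ (S.proj j).range.subtype)
    (e.injective.comp (LinearMap.inl_injective.comp (Submodule.subtype_injective _))) ?_ ?_).2
    ⟨?_, hc⟩
  · rw [range_residue S' hS']
    ext v
    constructor
    · rintro ⟨⟨_, u, rfl⟩, rfl⟩
      exact ⟨e (u, 0), hE.proj_castSucc j (u, 0)⟩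
    · rintro ⟨v, rfl⟩
      obtain ⟨y, rfl⟩ := e.surjective v
      exact ⟨⟨S.proj j y.1, y.1, rfl⟩, (hE.proj_castSucc j y).symm⟩
  · intro w
    rw [residue_apply]
    change S'.proj j.castSucc (S'.endA (e ((w : S.Space), 0))) = e (S.residue j w, 0)
    rw [hE.endA, hE.proj_castSucc, extB_fst, residue_apply]
    simp
  · rw [finrank_ker_residue S' hS', hE.n_castSucc]

/-- The image of this residue is the new summand, on which it acts by the lower right block `ρ₁ + ρ₂
- A`. -/
theorem IsExtension.hasKerDims_residue_last (hE : S.IsExtension ρ₁ ρ₂ S' e)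
    (hS' : S'.RankConditions) {rest : Column}
    (h : HasKerDims (S.endAQuad ρ₁ ρ₂) rest) :
    HasKerDims (S'.residue (Fin.last p))
      ((0, S.rank) :: rest.map fun x => (ρ₁ + ρ₂ - x.1, x.2)) := by
  refine (HasKerDims.cons_iff (g := (ρ₁ + ρ₂) • 1 - S.endAQuad ρ₁ ρ₂) ?_
    (e.toLinearMap ∘ₗ LinearMap.inr ℂ _ _) (e.injective.comp LinearMap.inr_injective) ?_ ?_).2
    ⟨?_, h.smul_one_sub _⟩
  · intro x hx _
    obtain ⟨y, hy, rfl⟩ := List.mem_map.1 hx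
    have a := (h.le_finrank_ker hy).trans (Submodule.finrank_le _)
    exact a.trans ((Submodule.finrank_le _).trans S.finrank_space.le)
  · rw [range_residue S' hS']
    ext v
    constructor
    · rintro ⟨w, rfl⟩
      exact ⟨e (0, w), hE.proj_last (0, w)⟩
    · rintro ⟨v, rfl⟩
      obtain ⟨y, rfl⟩ := e.surjective v
      exact ⟨y.2, (hE.proj_last y).symm⟩
  · intro w
    rw [residue_apply]
    change S'.proj (Fin.last p) (S'.endA (e (0, w))) = e (0, ((ρ₁ + ρ₂) • 1 - S.endAQuad ρ₁ ρ₂) w)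
    rw [hE.endA, hE.proj_last]
    congr 1
    refine ExtSum.ext _ _ _ rfl ?_
    rw [extB_snd]
    simp only [LinearMap.sub_apply, LinearMap.smul_apply, End.one_apply, Submodule.coe_sub,
      Submodule.coe_smul, endAQuad_apply, map_zero]
    module
  · rw [finrank_ker_residue S' hS', hE.rank_eq, hE.n_last]
    omega

end System
end Okubo

theorem mainTheorem2 {p : ℕ} (S : Okubo.System p) (hS : S.RankConditions)
    (ρ₁ ρ₂ : ℂ) (hρ : ρ₁ * ρ₂ ≠ 0) (s : ℂ) (hs : ∀ j, s ≠ S.t j) :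
    ∃ S' : Okubo.System (p + 1),
      -- the points and block sizes of the new system
      (∀ j : Fin p, S'.t j.castSucc = S.t j) ∧ S'.t (Fin.last p) = s ∧
      (∀ j : Fin p, S'.n j.castSucc = S.n j) ∧
      S'.n (Fin.last p) = Module.finrank ℂ (LinearMap.range (S.quad ρ₁ ρ₂)) ∧
      S'.rank = Module.finrank ℂ (S.extSpace ρ₁ ρ₂) ∧
      S'.rank = S.rank + Module.finrank ℂ (LinearMap.range (S.quad ρ₁ ρ₂)) ∧
      -- its matrices are `T̂` and `Â` under an identification of the spaces
      (∃ e : S.extSpace ρ₁ ρ₂ ≃ₗ[ℂ] S'.Space,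
        Matrix.toLin' S'.T = e.conj (S.extT ρ₁ ρ₂ s) ∧
        Matrix.toLin' S'.A = e.conj (S.extA ρ₁ ρ₂)) ∧
      -- it is obtained by Katz's operations
      Okubo.Similar
        (Okubo.middleConvolution ρ₁
          (Okubo.addition (Pi.single (Fin.last p) (ρ₂ - ρ₁))
            (Okubo.swapInfinity (Fin.last p)
              (Okubo.appendZero (Okubo.middleConvolution (-ρ₁) S.residue)))))
        S'.residue ∧
      S'.RankConditions ∧
      (Okubo.IsLinearlyIrreducible S'.residue ↔ Okubo.IsLinearlyIrreducible S.residue) ∧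
      -- the Riemann scheme
      (∀ (m₁ m₂ : ℕ) (rest : List (ℂ × ℕ)) (c : Fin p → Okubo.Column),
        (ρ₂ = ρ₁ → m₂ ≤ m₁) →
        (∀ x ∈ rest, x.1 = ρ₁ → x.2 ≤ m₁) →
        (∀ x ∈ rest, x.1 = ρ₂ → x.2 ≤ m₂) →
        Okubo.HasRiemannScheme S.residue
          ((-ρ₁, m₁) :: (-ρ₂, m₂) :: rest.map fun x => (-x.1, x.2))
          (fun j => (0, S.rank - S.n j) :: c j) →
        S'.rank + m₁ + m₂ = 2 * S.rank ∧
        Okubo.HasRiemannScheme S'.residue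
          [(-ρ₁, S.rank - m₂), (-ρ₂, S.rank - m₁)]
          (Fin.snoc (α := fun _ => Okubo.Column)
            (fun j => (0, S'.rank - S.n j) :: c j)
            ((0, S.rank) :: rest.map fun x => (ρ₁ + ρ₂ - x.1, x.2)))) := by
  obtain ⟨S', e, ht, ht', hE⟩ := S.exists_isExtension ρ₁ ρ₂ s hs
  have hS' := hE.rankConditions hS hρ
  refine ⟨S', ht, ht', hE.n_castSucc, hE.n_last, Okubo.System.rank_eq_finrank e, hE.rank_eq,
    ⟨_, hE.toLin'_T ht ht', hE.toLin'_A⟩, hE.similar hS hρ, hS', hE.isLinearlyIrreducible_iff hS hρ, ?_⟩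
  rintro m₁ m₂ rest c h12 h1 h2 ⟨hInf, hc⟩
  rw [Okubo.isSimilarToL_iff_hasKerDims] at hInf
  -- The column at infinity describes `-A`; reflecting with `σ = 0` turns it into one for `A`.
  have hA : Okubo.HasKerDims S.endA ((ρ₁, m₁) :: (ρ₂, m₂) :: rest) := by
    have a := hInf.smul_one_sub 0
    rw [S.sum_residue] at a
    simpa [Function.comp_def] using a
  obtain ⟨hm1, hm, hQ⟩ := Okubo.System.hasKerDims_endAQuad h12 h1 h2 hA
  refine ⟨by rw [hE.rank_eq]; omega, ?_, ?_⟩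
  · rw [Okubo.isSimilarToL_iff_hasKerDims, S'.sum_residue]
    simpa using (hE.hasKerDims_endA h12 hm1 hm).smul_one_sub 0
  · refine Fin.lastCases ?_ fun j => ?_
    · rw [Okubo.isSimilarToL_iff_hasKerDims, Fin.snoc_last]
      exact hE.hasKerDims_residue_last hS' hQ
    · rw [Okubo.isSimilarToL_iff_hasKerDims, Fin.snoc_castSucc]
      exact hE.hasKerDims_residue_castSucc hS hS' ((Okubo.isSimilarToL_iff_hasKerDims _ _).1 (hc j))
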